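/- Let $-\infty\le a<b\le\infty$ and let $n$ be a non-negative integer. Let $J\in\mathbb C^{n\times n}$ be a constant, invertible, skew-Hermitian matrix, and let $q,w$ be $n\times n$ matrices whose entries are complex distributions of order $0$ on $(a,b)$ (that is, locally finite complex measures), with $q$ Hermitian and $w$ non-negative. Write $\Delta_q(x)=Q^+(x)-Q^-(x)$ for the jump at $x$ of an antiderivative $Q$ of $q$, and assume that both matrices $2J\pm\Delta_q(x)$ are invertible for every $x\in(a,b)$. Let $\tilde W\ge 0$ be the matrix of Radon–Nikodym derivatives of $w$ with respect to the positive measure $\operatorname{tr}w$. Let $\mathcal L^2(w)$ be the space of measurable $f:(a,b)\to\mathbb C^n$ with $\int f^*\tilde Wf\,\operatorname{tr}w<\infty$, and let $L^2(w)$ be the Hilbert space of classes $[f]$ with scalar product $\langle f,g\rangle=\int f^*\tilde Wg\,\operatorname{tr}w$; write $\int Gwf=\int G\tilde Wf\,\operatorname{tr}w$. A function of locally bounded variation is balanced if at each point its value is the average of its left and right limits. The maximal relation $T_{\max}\subset L^2(w)\times L^2(w)$ is the set of all $([u],[f])$ with $u,f\in\mathcal L^2(w)$, $u$ balanced and of locally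 bounded variation on $(a,b)$, and $Ju'+qu=wf$ in the sense of distributions. Fix $x_0\in(a,b)$ and let $N_0=\{y(x_0)\}$, where $y$ ranges over all balanced functions of locally bounded variation with $Jy'+qy=0$ and $wy=0$. Let $T\subset T_{\max}$ be a linear relation which is self-adjoint ($T^*=T$) in $L^2(w)\times L^2(w)$, and let $\lambda\in\rho(T)$, i.e. $\ker(T-\lambda)=\{0\}$ and $\operatorname{ran}(T-\lambda)=L^2(w)$. For each $f\in\mathcal L^2(w)$ let $[u]=(T-\lambda)^{-1}[f]$. Then there is exactly one balanced function $v$ of locally bounded variation on $(a,b)$ in the class $[u]$ which satisfies $Jv'+qv=w(\lambda v+f)$ and $v(x_0)\in N_0^\perp$; denote it by $E_\lambda f$. Moreover, for every $x\in(a,b)$ there exists a matrix-valued function $G(x,\cdot,\lambda):(a,b)\to\mathbb C^{n\times n}$ such that the columns of $G(x,\cdot,\lambda)^*$ are in $\mathcal L^2(w)$ and $$(E_\lambda f)(x)=\int G(x,\cdot,\lambda)\,w f\qquad\text{for all } f\in\mathcal L^2(w).$$ -/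

import Mathlib

open MeasureTheory Filter Topology TopologicalSpace Matrix
open scoped Distributions ComplexOrder

noncomputable section

namespace DistSystem

/-- The open real interval `(a, b)`, where `a = -∞` and `b = ∞` are allowed. -/
def interval (a b : EReal) : Opens ℝ :=
  ⟨{x : ℝ | a < (x : EReal) ∧ (x : EReal) < b},
    isOpen_Ioo.preimage continuous_coe_real_ereal⟩

/-! ### Matrices of distributions of order zero -/

/-- `n × n` matrices whose entries are complex distributions of order `0` on `Ω`. -/
abbrev DistMatrix (Ω : Opens ℝ) (n : ℕ) := Matrix (Fin n) (Fin n) 𝓓'^{0}(Ω, ℂ)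

section Coefficients

variable {Ω : Opens ℝ} {n : ℕ}

/-- The matrix `q(φ)` obtained by applying all entries of `q` to the test function `φ`. -/
def pairing (q : DistMatrix Ω n) (φ : 𝓓^{0}(Ω, ℝ)) : Matrix (Fin n) (Fin n) ℂ :=
  Matrix.of fun j k => q j k φ

/-- `q` is Hermitian: `q j k` is the conjugate distribution of `q k j`. -/
def IsHermitianDist (q : DistMatrix Ω n) : Prop :=
  ∀ φ : 𝓓^{0}(Ω, ℝ), (pairing q φ).IsHermitian

/-- `w` is non-negative: for each vector `c`, the distribution `c* w c` is non-negative. -/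
def IsNonnegDist (w : DistMatrix Ω n) : Prop :=
  ∀ (c : Fin n → ℂ) (φ : 𝓓^{0}(Ω, ℝ)), (∀ x, 0 ≤ φ x) →
    0 ≤ star c ⬝ᵥ (pairing w φ *ᵥ c)

/-- The matrix of distributions `q` is the matrix of local measures `h dν` on `Ω`: `ν` is a
positive measure on `Ω` which is finite on compact sets, `h` is locally `ν`-integrable and
`q(φ) = ∫ φ h dν`. -/
structure Represents (q : DistMatrix Ω n) (ν : Measure ℝ) (h : ℝ → Matrix (Fin n) (Fin n) ℂ) :
    Prop where
  null_compl : ν (Ω : Set ℝ)ᶜ = 0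
  finite_compact : ∀ K : Set ℝ, IsCompact K → K ⊆ Ω → ν K < ⊤
  measurable : ∀ j k, Measurable fun x => h x j k
  integrableOn : ∀ K : Set ℝ, IsCompact K → K ⊆ Ω → ∀ j k, IntegrableOn (fun x => h x j k) K ν
  eq_integral : ∀ (φ : 𝓓^{0}(Ω, ℝ)) (j k), q j k φ = ∫ x, (φ x : ℂ) * h x j k ∂ν

open Classical in
/-- A positive measure together with a density, representing `q` as a matrix of local measures.
(By the Riesz representation theorem every `q` has such a representation, and the products
`h dν` agree for any two of them.) -/
def coeffMeasure (q : DistMatrix Ω n) : Measure ℝ × (ℝ → Matrix (Fin n) (Fin n) ℂ) :=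
  if H : ∃ p : Measure ℝ × (ℝ → Matrix (Fin n) (Fin n) ℂ), Represents q p.1 p.2 then H.choose
  else (0, 0)

/-- The jump `Δ_q(x) = Q⁺(x) - Q⁻(x)` of an antiderivative `Q` of `q`, i.e. the value which the
matrix-valued measure `q = dQ` assigns to the set `{x}`. -/
def jump (q : DistMatrix Ω n) (x : ℝ) : Matrix (Fin n) (Fin n) ℂ :=
  ((coeffMeasure q).1.real {x} : ℂ) • (coeffMeasure q).2 x

end Coefficients

/-! ### The space `L²(w)` -/

/-- A positive measure `S` and a measurable function `W` whose values are non-negative matrices;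
it stands for the non-negative matrix-valued measure `W dS`. -/
structure MatrixWeight (n : ℕ) where
  S : Measure ℝ
  W : ℝ → Matrix (Fin n) (Fin n) ℂ
  measurable : ∀ j k, Measurable fun x => W x j k
  posSemidef : ∀ x, (W x).PosSemidef

namespace MatrixWeight

variable {n : ℕ} (ω : MatrixWeight n)

/-- The function `f* W g`. -/
def form (f g : ℝ → Fin n → ℂ) (x : ℝ) : ℂ := star (f x) ⬝ᵥ (ω.W x *ᵥ g x)

/-- Measurable functions `f` with `∫ f* W f dS < ∞`. -/
def MemL2 (f : ℝ → Fin n → ℂ) : Prop :=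
  AEStronglyMeasurable f ω.S ∧ Integrable (ω.form f f) ω.S

theorem form_self_nonneg (f : ℝ → Fin n → ℂ) (x : ℝ) : 0 ≤ ω.form f f x :=
  (ω.posSemidef x).dotProduct_mulVec_nonneg (f x)

theorem form_add_left (f g h : ℝ → Fin n → ℂ) (x : ℝ) :
    ω.form (f + g) h x = ω.form f h x + ω.form g h x := by
  simp [form, add_dotProduct]

theorem form_add_right (f g h : ℝ → Fin n → ℂ) (x : ℝ) :
    ω.form h (f + g) x = ω.form h f x + ω.form h g x := by
  simp [form, mulVec_add, dotProduct_add]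

theorem form_smul_left (c : ℂ) (f h : ℝ → Fin n → ℂ) (x : ℝ) :
    ω.form (c • f) h x = star c * ω.form f h x := by
  simp [form]

theorem form_smul_right (c : ℂ) (f h : ℝ → Fin n → ℂ) (x : ℝ) :
    ω.form h (c • f) x = c * ω.form h f x := by
  simp [form, mulVec_smul]

theorem form_star (f g : ℝ → Fin n → ℂ) (x : ℝ) : star (ω.form f g x) = ω.form g f x := by
  have hW := (ω.posSemidef x).isHermitian
  rw [form, form, ← star_dotProduct_star, star_star, star_mulVec, hW.eq, dotProduct_mulVec,
    dotProduct_comm]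

theorem aestronglyMeasurable_form {f g : ℝ → Fin n → ℂ} (hf : AEStronglyMeasurable f ω.S)
    (hg : AEStronglyMeasurable g ω.S) : AEStronglyMeasurable (ω.form f g) ω.S := by
  have hfj : ∀ j, AEMeasurable (fun x => f x j) ω.S := fun j =>
    (measurable_pi_apply j).comp_aemeasurable hf.aemeasurable
  have hgj : ∀ j, AEMeasurable (fun x => g x j) ω.S := fun j =>
    (measurable_pi_apply j).comp_aemeasurable hg.aemeasurable
  have h : ω.form f g = fun x => ∑ j, star (f x j) * ∑ k, ω.W x j k * g x k := by
    funext x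
    simp [form, dotProduct, mulVec]
  rw [h]
  refine AEMeasurable.aestronglyMeasurable ?_
  refine Finset.aemeasurable_fun_sum _ fun j _ => ?_
  refine AEMeasurable.mul ?_ ?_
  · exact Complex.continuous_conj.measurable.comp_aemeasurable (hfj j)
  · exact Finset.aemeasurable_fun_sum _ fun k _ =>
      (ω.measurable j k).aemeasurable.mul (hgj k)

theorem norm_form_le (f g : ℝ → Fin n → ℂ) (x : ℝ) :
    ‖ω.form f g x‖ ≤ (ω.form f f x).re + (ω.form g g x).re := by
  obtain ⟨c, hc, hcz⟩ : ∃ c : ℂ, ‖c‖ = 1 ∧ c * ω.form f g x = ‖ω.form f g x‖ := by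
    by_cases hz : ω.form f g x = 0
    · exact ⟨1, by simp, by simp [hz]⟩
    · have hn : ‖ω.form f g x‖ ≠ 0 := norm_ne_zero_iff.mpr hz
      refine ⟨star (ω.form f g x) / ‖ω.form f g x‖, ?_, ?_⟩
      · simp [hn]
      · have hn' : (‖ω.form f g x‖ : ℂ) ≠ 0 := by exact_mod_cast hn
        rw [div_mul_eq_mul_div, div_eq_iff hn', mul_comm, Complex.star_def, Complex.mul_conj,
          Complex.normSq_eq_norm_sq]
        push_cast
        ring
  have h0 := ω.form_self_nonneg (f + (-c) • g) x
  have hcc : star c * c = 1 := by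
    rw [mul_comm, Complex.star_def, Complex.mul_conj, Complex.normSq_eq_norm_sq, hc]
    simp
  have hcz' : star c * ω.form g f x = ‖ω.form f g x‖ := by
    have := congrArg star hcz
    rw [star_mul, ω.form_star] at this
    rw [mul_comm, this]
    simp
  rw [ω.form_add_left, ω.form_add_right, ω.form_add_right, ω.form_smul_left, ω.form_smul_right,
    ω.form_smul_left, ω.form_smul_right] at h0
  have h1 : (ω.form f f x + -c * ω.form f g x +
      (star (-c) * ω.form g f x + star (-c) * (-c * ω.form g g x))) =
      ω.form f f x + ω.form g g x - 2 * (‖ω.form f g x‖ : ℂ) := by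
    have : star (-c) * (-c * ω.form g g x) = (star c * c) * ω.form g g x := by
      rw [star_neg]; ring
    rw [this, hcc, star_neg, neg_mul, neg_mul, hcz, hcz']
    ring
  rw [h1] at h0
  have h2 := (Complex.le_def.mp h0).1
  simp at h2
  have h3 := norm_nonneg (ω.form f g x)
  linarith

theorem MemL2.integrable_form {ω : MatrixWeight n} {f g : ℝ → Fin n → ℂ} (hf : ω.MemL2 f)
    (hg : ω.MemL2 g) : Integrable (ω.form f g) ω.S :=
  (hf.2.re.add hg.2.re).mono' (ω.aestronglyMeasurable_form hf.1 hg.1)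
    (Eventually.of_forall fun x => ω.norm_form_le f g x)

/-- The vector space `𝓛²(w)` of representatives, as a space of functions. -/
def l2Submodule : Submodule ℂ (ℝ → Fin n → ℂ) where
  carrier := {f | ω.MemL2 f}
  zero_mem' := by
    refine ⟨aestronglyMeasurable_const, ?_⟩
    have : ω.form 0 0 = fun _ => 0 := by funext x; simp [form]
    rw [this]
    exact integrable_zero _ _ _
  add_mem' := by
    intro f g hf hg
    refine ⟨hf.1.add hg.1, ?_⟩
    have : ω.form (f + g) (f + g) =
        fun x => (ω.form f f x + ω.form f g x) + (ω.form g f x + ω.form g g x) := by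
      funext x
      rw [ω.form_add_left, ω.form_add_right, ω.form_add_right]
    rw [this]
    exact (hf.2.add (hf.integrable_form hg)).add ((hg.integrable_form hf).add hg.2)
  smul_mem' := by
    intro c f hf
    refine ⟨hf.1.const_smul c, ?_⟩
    have : ω.form (c • f) (c • f) = fun x => star c * (c * ω.form f f x) := by
      funext x
      rw [ω.form_smul_left, ω.form_smul_right]
    rw [this]
    exact (hf.2.const_mul c).const_mul (star c)

/-- The type of elements of `𝓛²(w)`. (A separate type, so that it carries the topology of the
seminorm below and not that of pointwise convergence.) -/
def L2Fun : Type := ω.l2Submodule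

instance instAddCommGroupL2Fun : AddCommGroup ω.L2Fun :=
  inferInstanceAs (AddCommGroup ω.l2Submodule)

instance instModuleL2Fun : Module ℂ ω.L2Fun :=
  inferInstanceAs (Module ℂ ω.l2Submodule)

instance instCoeFunL2Fun : CoeFun ω.L2Fun fun _ => ℝ → Fin n → ℂ := ⟨fun f => f.1⟩

/-- The semi-scalar product `⟨f, g⟩ = ∫ f* W g dS` on `𝓛²(w)`. -/
@[reducible]
def core : PreInnerProductSpace.Core ℂ ω.L2Fun where
  inner f g := ∫ x, ω.form f g x ∂ω.S
  conj_inner_symm f g := by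
    rw [← integral_conj]
    exact integral_congr_ae (Eventually.of_forall fun x => ω.form_star g f x)
  re_inner_nonneg f := by
    have h : RCLike.re (∫ x, ω.form f f x ∂ω.S) = ∫ x, RCLike.re (ω.form f f x) ∂ω.S :=
      (integral_re f.2.2).symm
    rw [h]
    exact integral_nonneg fun x => (Complex.le_def.mp (ω.form_self_nonneg f x)).1
  add_left f g h := by
    rw [← integral_add (f.2.integrable_form h.2) (g.2.integrable_form h.2)]
    exact integral_congr_ae (Eventually.of_forall fun x => ω.form_add_left f g h x)
  smul_left f g c := by
    rw [← integral_const_mul]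
    exact integral_congr_ae (Eventually.of_forall fun x => ω.form_smul_left c f g x)

instance instSeminormedAddCommGroupL2Fun : SeminormedAddCommGroup ω.L2Fun :=
  letI := ω.core
  InnerProductSpace.Core.toSeminormedAddCommGroup (𝕜 := ℂ)

instance instInnerProductSpaceL2Fun : InnerProductSpace ℂ ω.L2Fun :=
  InnerProductSpace.ofCore ω.core

/-- The Hilbert space `L²(w)`: the quotient of `𝓛²(w)` by the functions of norm zero. -/
def L2 : Type := SeparationQuotient ω.L2Fun

instance instNormedAddCommGroupL2 : NormedAddCommGroup ω.L2 :=
  inferInstanceAs (NormedAddCommGroup (SeparationQuotient ω.L2Fun))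

instance instInnerProductSpaceL2 : InnerProductSpace ℂ ω.L2 :=
  inferInstanceAs (InnerProductSpace ℂ (SeparationQuotient ω.L2Fun))

/-- The class `[f] ∈ L²(w)` of `f ∈ 𝓛²(w)`. -/
def toL2 (f : ω.L2Fun) : ω.L2 := SeparationQuotient.mk (X := ω.L2Fun) f

end MatrixWeight

section Weight

variable {Ω : Opens ℝ} {n : ℕ}

open Classical in
/-- The positive measure `S = tr w` and the matrix `W` of Radon–Nikodym derivatives of the
entries of `w` with respect to `S`, for a non-negative matrix `w` of distributions. (They always
exist, and `S` is unique while `W` is unique up to `S`-null sets. The normalization `tr W = 1`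
expresses that `S = tr w`.) -/
def weight (w : DistMatrix Ω n) : MatrixWeight n :=
  if H : ∃ ω : MatrixWeight n, Represents w ω.S ω.W ∧ ∀ᵐ x ∂ω.S, (ω.W x).trace = 1 then H.choose
  else ⟨0, 0, fun _ _ => measurable_const, fun _ => PosSemidef.zero⟩

end Weight

/-! ### The differential equation `J u' + q u = w f` -/

section Equation

variable {Ω : Opens ℝ} {n : ℕ}

/-- `u` is a balanced function of locally bounded variation on `Ω`. -/
def IsBalancedBV (Ω : Opens ℝ) (u : ℝ → Fin n → ℂ) : Prop :=
  LocallyBoundedVariationOn u (Ω : Set ℝ) ∧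
    ∀ x ∈ Ω, ∃ l r : Fin n → ℂ, Tendsto u (𝓝[<] x) (𝓝 l) ∧ Tendsto u (𝓝[>] x) (𝓝 r) ∧
      u x = (1 / 2 : ℂ) • (r + l)

/-- `J u' + q u = w f` in the sense of distributions on `Ω`, where `(q u)(φ) = ∫ φ u dQ` with
`q = dQ`, and `(w f)(φ) = ∫ φ W f dS`. -/
def IsSolution (J : Matrix (Fin n) (Fin n) ℂ) (q w : DistMatrix Ω n) (u f : ℝ → Fin n → ℂ) :
    Prop :=
  ∀ (φ : 𝓓(Ω, ℝ)) (i : Fin n),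
    -(∫ x, ((deriv φ x : ℝ) : ℂ) * (J *ᵥ u x) i)
      + (∫ x, (φ x : ℂ) * ((coeffMeasure q).2 x *ᵥ u x) i ∂(coeffMeasure q).1)
      = ∫ x, (φ x : ℂ) * ((weight w).W x *ᵥ f x) i ∂(weight w).S

/-- The maximal relation `T_max`. -/
def Tmax (J : Matrix (Fin n) (Fin n) ℂ) (q w : DistMatrix Ω n) :
    Set ((weight w).L2 × (weight w).L2) :=
  {p | ∃ u f : (weight w).L2Fun, (weight w).toL2 u = p.1 ∧ (weight w).toL2 f = p.2 ∧
    IsBalancedBV Ω u ∧ IsSolution J q w u f}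

/-- The space `𝓛₀` of balanced solutions of `J u' + q u = 0` for which `w u` is the zero
distribution. -/
def zeroSolutions (J : Matrix (Fin n) (Fin n) ℂ) (q w : DistMatrix Ω n) :
    Set (ℝ → Fin n → ℂ) :=
  {u | IsBalancedBV Ω u ∧ IsSolution J q w u 0 ∧
    ∀ (φ : 𝓓(Ω, ℝ)) (i : Fin n), ∫ x, (φ x : ℂ) * ((weight w).W x *ᵥ u x) i ∂(weight w).S = 0}

/-- `v` represents the value `E p` of the evaluation operator at `p = ([u], [f]) ∈ T_max`: it is a
balanced representative of `[u]` with `J v' + q v = w f` and `v(x₀) ∈ N₀ᗮ`, where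
`N₀ = {y(x₀) : y ∈ 𝓛₀}`. -/
def IsEvaluation (J : Matrix (Fin n) (Fin n) ℂ) (q w : DistMatrix Ω n) (x₀ : ℝ)
    (p : (weight w).L2 × (weight w).L2) (v : (weight w).L2Fun) : Prop :=
  (weight w).toL2 v = p.1 ∧ IsBalancedBV Ω v ∧
    (∃ f : (weight w).L2Fun, (weight w).toL2 f = p.2 ∧ IsSolution J q w v f) ∧
    ∀ y ∈ zeroSolutions J q w, star (y x₀) ⬝ᵥ v x₀ = 0

end Equation

/-! ### Linear relations -/

/-- The resolvent set of a linear relation `T`: `ker (T - z) = {0}` and `ran (T - z) = H`, where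
`T - z = {(u, f - z u) : (u, f) ∈ T}`. -/
def relResolventSet {H : Type*} [AddCommGroup H] [Module ℂ H] (T : Submodule ℂ (H × H)) : Set ℂ :=
  {z | (∀ u f : H, (u, f) ∈ T → f - z • u = 0 → u = 0) ∧
    ∀ g : H, ∃ u f : H, (u, f) ∈ T ∧ f - z • u = g}

/-- `v` is the distinguished balanced representative `E_z f` of `R_z [f]`: with `[u] = R_z [f]`,
i.e. `([u], z [u] + [f]) ∈ T`, it is the value of the evaluation operator at
`([u], z [u] + [f])`. -/
def IsResolventEval {Ω : Opens ℝ} {n : ℕ} (J : Matrix (Fin n) (Fin n) ℂ) (q w : DistMatrix Ω n)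
    (x₀ : ℝ) (T : Submodule ℂ ((weight w).L2 × (weight w).L2)) (z : ℂ)
    (f v : (weight w).L2Fun) : Prop :=
  ∃ u : (weight w).L2, (u, z • u + (weight w).toL2 f) ∈ T ∧
    IsEvaluation J q w x₀ (u, z • u + (weight w).toL2 f) v

end DistSystem

end

open DistSystem

/-! For fixed `x`, the value `(E_λ f)(x)` depends linearly on the class `[f]`. If this dependence is
continuous, the Riesz representation theorem in the Hilbert space `L²(w)` turns each component into
an inner product with some `g i`, and the vectors `(g i)*` are the rows of `G(x, ·, λ)`. The work
lies in the continuity and in the completeness of `L²(w)`.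

Completeness (`completeSpace_L2Fun`): `f ↦ √W f` is an isometry into an ordinary `L²` space, and its
range, the functions with values in `ran √W(x)`, is closed.

A priori bound (`exists_bound`): testing the equation with smoothed indicator functions gives an
integral equation in which end points carry half weights, which matches the balanced values
(`integral_equation`). Near a point `p` the atom of `q` at `p` is absorbed into `J ± ½ Δ_q(p)`, and
the remaining mass is small. Since `J` and `J ± ½ Δ_q(p)` are invertible, `u(x)` and `u(p)` control
each other up to the norm of the right-hand side. Connectedness of the interval makes the control
global, so a solution is determined by its value at `x₀` and its right-hand side.

Existence and uniqueness of `E_λ f`: two balanced representatives solving the same equation differ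
by an element of `𝓛₀`. Orthogonal projection onto `N₀` selects one of them, and the a priori bound
shows that no other satisfies the same normalization.

Continuity (`isClosed_resolventGraph`, `exists_continuous_evaluation`): the tuples `(f, (E_λ f)(x₀),
(E_λ f)(x), R_λ f)` form a closed subspace which projects bijectively onto the first factor, so the
open mapping theorem applies. For closedness, `T` is closed, being an adjoint. Along a convergent
sequence of tuples the evaluations minus that of the limit pair converge pointwise, by the a priori
bound, to some `u ∈ 𝓛₀`. As `u(x₀)` is a limit of vectors in `N₀ᗮ`, it is orthogonal to itself,
whence `u = 0` (`tendsto_zero_of_isEvaluation`). -/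

namespace DistSystem

/-! ### Square roots and regularized inverses of positive semidefinite matrices -/

section MatrixSquareRoot

variable {n : ℕ}

-- Continuity in the matrix is what makes `x ↦ √W(x)` measurable when `W` is.
open scoped MatrixOrder Matrix.Norms.L2Operator in
theorem continuousOn_matrix_sqrt :
    ContinuousOn (fun A : Matrix (Fin n) (Fin n) ℂ => cfc NNReal.sqrt A) {A | A.PosSemidef} := by
  refine ContinuousOn.cfc_nnreal_of_mem_nhdsSet (s := Set.univ) NNReal.sqrt Filter.univ_mem
    continuousOn_id ?_ NNReal.continuous_sqrt.continuousOn
  intro A hA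
  exact Matrix.nonneg_iff_posSemidef.mpr hA

open scoped MatrixOrder Matrix.Norms.L2Operator in
theorem matrix_sqrt_spec {A : Matrix (Fin n) (Fin n) ℂ} (hA : A.PosSemidef) :
    (cfc NNReal.sqrt A).PosSemidef ∧ cfc NNReal.sqrt A * cfc NNReal.sqrt A = A := by
  have hA' : 0 ≤ A := Matrix.nonneg_iff_posSemidef.mpr hA
  have h := CFC.sqrt_eq_cfc (a := A)
  rw [← h]
  exact ⟨Matrix.nonneg_iff_posSemidef.mp (CFC.sqrt_nonneg A), CFC.sqrt_mul_sqrt_self A⟩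

/-- A measurable family of positive semidefinite matrices has a measurable square root. -/
theorem exists_measurable_sqrt {α : Type*} [MeasurableSpace α]
    {W : α → Matrix (Fin n) (Fin n) ℂ} (hW : ∀ j k, Measurable fun x => W x j k)
    (hpos : ∀ x, (W x).PosSemidef) :
    ∃ A : α → Matrix (Fin n) (Fin n) ℂ, (∀ j k, Measurable fun x => A x j k) ∧
      ∀ x, (A x).PosSemidef ∧ A x * A x = W x := by
  open scoped MatrixOrder Matrix.Norms.L2Operator in
  refine ⟨fun x => cfc NNReal.sqrt (W x), fun j k => ?_, fun x => matrix_sqrt_spec (hpos x)⟩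
  -- The product σ-algebra is the Borel one, so entrywise measurability of `W` can be composed with
  -- the continuous square root.
  let _ : MeasurableSpace (Matrix (Fin n) (Fin n) ℂ) := MeasurableSpace.pi
  have : BorelSpace (Matrix (Fin n) (Fin n) ℂ) :=
    inferInstanceAs (BorelSpace (Fin n → Fin n → ℂ))
  have hc := continuousOn_iff_continuous_domRestrict.mp (continuousOn_matrix_sqrt (n := n))
  have hm : Measurable fun x => (⟨W x, hpos x⟩ : {A : Matrix (Fin n) (Fin n) ℂ | A.PosSemidef}) :=
    Measurable.subtype_mk (measurable_pi_lambda _ fun j => measurable_pi_lambda _ fun k => hW j k)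
  have hjk : Continuous fun A : {A : Matrix (Fin n) (Fin n) ℂ | A.PosSemidef} =>
      (({A : Matrix (Fin n) (Fin n) ℂ | A.PosSemidef}.domRestrict
        fun A : Matrix (Fin n) (Fin n) ℂ => cfc NNReal.sqrt A) A) j k :=
    (continuous_apply k).comp ((continuous_apply j).comp hc)
  exact hjk.measurable.comp hm

theorem norm_toLp_sq (v : Fin n → ℂ) :
    ((‖WithLp.toLp 2 v‖ ^ 2 : ℝ) : ℂ) = star v ⬝ᵥ v := by
  rw [EuclideanSpace.norm_sq_eq]
  simp [dotProduct, Complex.conj_mul']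

/-- `A²= A*A` has the same rank as `A`, so `ran A² = ran A`. The vector `A z` then serves as a
preimage of `A y` which itself lies in `ran A`. -/
theorem exists_mulVec_mulVec_eq {A : Matrix (Fin n) (Fin n) ℂ} (hA : A.IsHermitian)
    (y : Fin n → ℂ) : ∃ z, A *ᵥ (A *ᵥ z) = A *ᵥ y := by
  have hle : LinearMap.range (A * A).mulVecLin ≤ LinearMap.range A.mulVecLin := by
    rw [mulVecLin_mul]
    exact LinearMap.range_comp_le_range _ _
  have hr : (A * A).rank = A.rank := by
    have := rank_conjTranspose_mul_self A
    rwa [hA.eq] at this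
  have heq := Submodule.eq_of_le_of_finrank_eq hle hr
  have hy : A *ᵥ y ∈ LinearMap.range A.mulVecLin := ⟨y, rfl⟩
  rw [← heq] at hy
  obtain ⟨z, hz⟩ := hy
  exact ⟨z, by simpa using hz⟩

/-- The regularized inverses of a positive semidefinite matrix converge on its range to a
preimage. -/
theorem tendsto_regularized_inv {A : Matrix (Fin n) (Fin n) ℂ} (hA : A.PosSemidef)
    (y : Fin n → ℂ) : ∃ p, A *ᵥ p = A *ᵥ y ∧
      Tendsto (fun m : ℕ => (A + ((1 / ((m : ℝ) + 1) : ℝ) : ℂ) • 1)⁻¹ *ᵥ (A *ᵥ y)) atTop (𝓝 p) := by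
  obtain ⟨z, hz⟩ := exists_mulVec_mulVec_eq hA.isHermitian y
  refine ⟨A *ᵥ z, hz, ?_⟩
  have hunit : ∀ ε : ℝ, 0 < ε → IsUnit (A + (ε : ℂ) • 1) := fun ε hε =>
    (PosDef.posSemidef_add hA ((PosDef.one).smul (by exact_mod_cast hε))).isUnit
  -- Writing `A y = (A + ε) A z - ε A z` isolates the error term, which tends to zero once `(A +
  -- ε)⁻¹ A z` is bounded in `ε`.
  have key : ∀ ε : ℝ, 0 < ε →
      (A + (ε : ℂ) • 1)⁻¹ *ᵥ (A *ᵥ y) = A *ᵥ z - (ε : ℂ) • ((A + (ε : ℂ) • 1)⁻¹ *ᵥ (A *ᵥ z)) := by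
    intro ε hε
    have h1 : A *ᵥ y = (A + (ε : ℂ) • 1) *ᵥ (A *ᵥ z) - (ε : ℂ) • (A *ᵥ z) := by
      rw [add_mulVec, smul_mulVec, one_mulVec, hz]
      simp
    have h2 := (Matrix.isUnit_iff_isUnit_det _).mp (hunit ε hε)
    rw [h1, mulVec_sub, mulVec_mulVec, nonsing_inv_mul _ h2, one_mulVec, mulVec_smul]
  -- For `v = (A + ε)⁻¹ A z` one has `A (z - v) = ε v`. Positivity of `A` gives `Re ⟨z - v, v⟩ ≥ 0`,
  -- so `‖v‖² ≤ ‖z‖ ‖v‖`.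
  have bound : ∀ ε : ℝ, 0 < ε →
      ‖WithLp.toLp 2 ((A + (ε : ℂ) • 1)⁻¹ *ᵥ (A *ᵥ z))‖ ≤ ‖WithLp.toLp 2 z‖ := by
    intro ε hε
    set v := (A + (ε : ℂ) • 1)⁻¹ *ᵥ (A *ᵥ z) with hv
    have h2 := (Matrix.isUnit_iff_isUnit_det _).mp (hunit ε hε)
    have h3 : A *ᵥ v + (ε : ℂ) • v = A *ᵥ z := by
      have : (A + (ε : ℂ) • 1) *ᵥ v = A *ᵥ z := by
        rw [hv, mulVec_mulVec, mul_nonsing_inv _ h2, one_mulVec]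
      rwa [add_mulVec, smul_mulVec, one_mulVec] at this
    have h4 : A *ᵥ (z - v) = (ε : ℂ) • v := by
      rw [mulVec_sub, ← h3]; simp
    have h5 := hA.dotProduct_mulVec_nonneg (z - v)
    rw [h4, dotProduct_smul, smul_eq_mul] at h5
    have h6 : 0 ≤ (star (z - v) ⬝ᵥ v).re := by
      have := (Complex.le_def.mp h5).1
      rw [Complex.re_ofReal_mul] at this
      exact (mul_nonneg_iff_of_pos_left hε).mp (by simpa using this)
    rw [star_sub, sub_dotProduct, Complex.sub_re, ← norm_toLp_sq, Complex.ofReal_re] at h6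
    have h7 : (star z ⬝ᵥ v).re ≤ ‖WithLp.toLp 2 z‖ * ‖WithLp.toLp 2 v‖ := by
      have : star z ⬝ᵥ v = inner ℂ (WithLp.toLp 2 z) (WithLp.toLp 2 v) := by
        rw [EuclideanSpace.inner_toLp_toLp, dotProduct_comm]
      rw [this]
      exact (Complex.re_le_norm _).trans (norm_inner_le_norm _ _)
    by_contra! hlt
    nlinarith [norm_nonneg (WithLp.toLp 2 z)]
  have hlim : Tendsto (fun m : ℕ => (((1 / ((m : ℝ) + 1) : ℝ) : ℂ)) •
      WithLp.toLp 2 ((A + ((1 / ((m : ℝ) + 1) : ℝ) : ℂ) • 1)⁻¹ *ᵥ (A *ᵥ z))) atTop (𝓝 0) := by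
    refine squeeze_zero_norm (a := fun m : ℕ => (1 / ((m : ℝ) + 1)) * ‖WithLp.toLp 2 z‖) ?_ ?_
    · intro m
      have hm : (0 : ℝ) < 1 / ((m : ℝ) + 1) := by positivity
      rw [norm_smul, Complex.norm_real, Real.norm_of_nonneg hm.le]
      exact mul_le_mul_of_nonneg_left (bound _ hm) hm.le
    · simpa using (tendsto_one_div_add_atTop_nhds_zero_nat (𝕜 := ℝ)).mul_const ‖WithLp.toLp 2 z‖
  have hlim' := (PiLp.continuous_ofLp 2 (fun _ : Fin n => ℂ)).continuousAt.tendsto.comp hlim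
  have hlim2 := (tendsto_const_nhds (x := A *ᵥ z)).sub hlim'
  simp only [WithLp.ofLp_zero, sub_zero] at hlim2
  refine hlim2.congr fun m => ?_
  rw [key _ (by positivity)]
  rfl

end MatrixSquareRoot

/-! ### Completeness of `L²(w)` -/

namespace MatrixWeight

variable {n : ℕ} (ω : MatrixWeight n)

theorem aestronglyMeasurable_mulVec {α : Type*} [MeasurableSpace α] {μ : Measure α}
    {A : α → Matrix (Fin n) (Fin n) ℂ} (hA : ∀ j k, Measurable fun x => A x j k)
    {f : α → Fin n → ℂ} (hf : AEStronglyMeasurable f μ) :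
    AEStronglyMeasurable (fun x => A x *ᵥ f x) μ := by
  refine AEMeasurable.aestronglyMeasurable (aemeasurable_pi_lambda _ fun j => ?_)
  simp only [mulVec, dotProduct]
  exact Finset.aemeasurable_fun_sum _ fun k _ => (hA j k).aemeasurable.mul
    ((measurable_pi_apply k).comp_aemeasurable hf.aemeasurable)

theorem inner_L2Fun (f g : ω.L2Fun) : inner ℂ f g = ∫ x, ω.form f g x ∂ω.S := rfl

/-- By Cramer's rule the entries are quotients of polynomials in the entries of `A`. Singular
matrices need no exception, as both sides of the formula are then zero. -/
theorem measurable_inv {α : Type*} [MeasurableSpace α]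
    {A : α → Matrix (Fin n) (Fin n) ℂ} (hA : ∀ j k, Measurable fun x => A x j k) (j k : Fin n) :
    Measurable fun x => (A x)⁻¹ j k := by
  have hdet : ∀ B : α → Matrix (Fin n) (Fin n) ℂ, (∀ j k, Measurable fun x => B x j k) →
      Measurable fun x => (B x).det := by
    intro B hB
    simp only [det_apply]
    exact Finset.measurable_fun_sum _ fun σ _ =>
      (Finset.measurable_fun_prod _ fun i _ => hB _ _).const_smul _
  simp only [inv_def, Matrix.smul_apply, smul_eq_mul, Ring.inverse_eq_inv, adjugate_apply]
  refine (hdet A hA).inv.mul (hdet _ fun i l => ?_)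
  by_cases hik : i = k
  · subst hik; simp only [updateRow_self, measurable_const]
  · simpa only [updateRow_ne hik] using hA i l

/-- `𝓛²(w)` is isometric to a closed subspace of a space of square integrable functions. -/
theorem completeSpace_L2Fun : CompleteSpace ω.L2Fun := by
  obtain ⟨A, hAm, hA⟩ := exists_measurable_sqrt ω.measurable ω.posSemidef
  have hform : ∀ (f g : ℝ → Fin n → ℂ) x,
      ω.form f g x = inner ℂ (WithLp.toLp 2 (A x *ᵥ f x)) (WithLp.toLp 2 (A x *ᵥ g x)) := by
    intro f g x
    rw [EuclideanSpace.inner_toLp_toLp, dotProduct_comm, form, ← (hA x).2, star_mulVec,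
      (hA x).1.isHermitian.eq, ← dotProduct_mulVec, mulVec_mulVec]
  have hmeas : ∀ f : ℝ → Fin n → ℂ, AEStronglyMeasurable f ω.S →
      AEStronglyMeasurable (fun x => WithLp.toLp 2 (A x *ᵥ f x)) ω.S := fun f hf =>
    (PiLp.continuous_toLp 2 (fun _ : Fin n => ℂ)).comp_aestronglyMeasurable
      (aestronglyMeasurable_mulVec hAm hf)
  have hmem : ∀ f : ℝ → Fin n → ℂ, AEStronglyMeasurable f ω.S →
      (MemLp (fun x => WithLp.toLp 2 (A x *ᵥ f x)) 2 ω.S ↔ Integrable (ω.form f f) ω.S) := by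
    intro f hf
    rw [memLp_two_iff_integrable_sq_norm (hmeas f hf)]
    have : ω.form f f = fun x => ((‖WithLp.toLp 2 (A x *ᵥ f x)‖ ^ 2 : ℝ) : ℂ) := by
      funext x
      rw [hform, inner_self_eq_norm_sq_to_K]
      norm_cast
    rw [this]
    exact ⟨fun h => h.ofReal, fun h => h.re⟩
  -- Since `f* W g = (A f)* (A g)` for `A = √W`, the map `f ↦ A f` preserves the semi-norm, and
  -- completeness reduces to closedness of its range.
  let Ψ : ω.L2Fun →ₗ[ℂ] Lp (EuclideanSpace ℂ (Fin n)) 2 ω.S :=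
    { toFun := fun f => ((hmem f f.2.1).mpr f.2.2).toLp _
      map_add' := fun f g => by
        rw [← MemLp.toLp_add]
        refine MemLp.toLp_congr _ _ (Eventually.of_forall fun x => ?_)
        change WithLp.toLp 2 (A x *ᵥ (f x + g x)) = _
        rw [mulVec_add]; rfl
      map_smul' := fun c f => by
        rw [RingHom.id_apply, ← MemLp.toLp_const_smul]
        refine MemLp.toLp_congr _ _ (Eventually.of_forall fun x => ?_)
        change WithLp.toLp 2 (A x *ᵥ (c • f x)) = _
        rw [mulVec_smul]; rfl }
  have hcoe : ∀ f : ω.L2Fun, Ψ f =ᵐ[ω.S] fun x => WithLp.toLp 2 (A x *ᵥ f x) := fun f =>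
    ((hmem f f.2.1).mpr f.2.2).coeFn_toLp
  have hnorm : ∀ f, ‖Ψ f‖ = ‖f‖ := by
    intro f
    rw [norm_eq_sqrt_re_inner (𝕜 := ℂ), norm_eq_sqrt_re_inner (𝕜 := ℂ) f, inner_L2Fun,
      MeasureTheory.L2.inner_def]
    congr 2
    refine integral_congr_ae ?_
    filter_upwards [hcoe f] with x hx
    rw [hx, hform]
  have hiso : Isometry Ψ := AddMonoidHomClass.isometry_of_norm Ψ hnorm
  rw [completeSpace_iff_isComplete_univ, ← hiso.isUniformInducing.isComplete_iff, Set.image_univ]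
  refine IsClosed.isComplete ?_
  refine isClosed_of_closure_subset fun g hg => ?_
  obtain ⟨s, hs, hlim⟩ := mem_closure_iff_seq_limit.mp hg
  choose f hf using hs
  obtain ⟨ns, -, hns⟩ := (tendstoInMeasure_of_tendsto_Lp hlim).exists_seq_tendsto_ae
  -- A subsequence converges almost everywhere, and `ran A(x)` is closed because it is
  -- finite-dimensional.
  have hrange : ∀ᵐ x ∂ω.S, ∃ y, WithLp.toLp 2 (A x *ᵥ y) = g x := by
    have hall : ∀ᵐ x ∂ω.S, ∀ m, Ψ (f m) x = WithLp.toLp 2 (A x *ᵥ f m x) :=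
      ae_all_iff.mpr fun m => hcoe (f m)
    filter_upwards [hns, hall] with x hx hx'
    have hc : IsClosed (LinearMap.range (A x).mulVecLin : Set (Fin n → ℂ)) :=
      Submodule.closed_of_finiteDimensional _
    have hx2 := (PiLp.continuous_ofLp 2 (fun _ : Fin n => ℂ)).continuousAt.tendsto.comp hx
    have := hc.mem_of_tendsto hx2 (Eventually.of_forall fun m => by
      rw [Function.comp_apply, ← hf, hx']
      exact ⟨f (ns m) x, rfl⟩)
    obtain ⟨y, hy⟩ := this
    refine ⟨y, ?_⟩
    have hy' : A x *ᵥ y = WithLp.ofLp (g x) := by simpa using hy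
    rw [hy']
  have hgm : AEStronglyMeasurable (fun x => WithLp.ofLp (g x)) ω.S :=
    (PiLp.continuous_ofLp 2 (fun _ : Fin n => ℂ)).comp_aestronglyMeasurable
      (Lp.aestronglyMeasurable g)
  -- Pointwise preimages have to be chosen measurably: the regularized inverses applied to `g` are
  -- measurable and converge to one.
  obtain ⟨F, hF, hFlim⟩ := measurable_limit_of_tendsto_metrizable_ae (μ := ω.S) (L := atTop)
    (f := fun (m : ℕ) x => (A x + ((1 / ((m : ℝ) + 1) : ℝ) : ℂ) • 1)⁻¹ *ᵥ WithLp.ofLp (g x))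
    (fun m => (aestronglyMeasurable_mulVec (measurable_inv fun j k => by
      simpa using (hAm j k).add_const _) hgm).aemeasurable) (by
      filter_upwards [hrange] with x ⟨y, hy⟩
      obtain ⟨p, -, hp⟩ := tendsto_regularized_inv (hA x).1 y
      exact ⟨p, by simpa [← hy] using hp⟩)
  have hAF : (fun x => WithLp.toLp 2 (A x *ᵥ F x)) =ᵐ[ω.S] g := by
    filter_upwards [hrange, hFlim] with x ⟨y, hy⟩ hx
    obtain ⟨p, hpy, hp⟩ := tendsto_regularized_inv (hA x).1 y
    have : F x = p := tendsto_nhds_unique hx (by simpa [← hy] using hp)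
    rw [this, hpy, hy]
  have hFs : AEStronglyMeasurable F ω.S := hF.aestronglyMeasurable
  have hFmem : ω.MemL2 F := ⟨hFs, (hmem F hFs).mp ((Lp.memLp g).ae_eq hAF.symm)⟩
  refine ⟨(⟨F, hFmem⟩ : ω.l2Submodule), ?_⟩
  exact Lp.ext ((hcoe _).trans hAF)

instance completeSpace_L2 : CompleteSpace ω.L2 := by
  have := ω.completeSpace_L2Fun
  exact inferInstanceAs (CompleteSpace (SeparationQuotient ω.L2Fun))

end MatrixWeight

/-! ### Matrices of locally integrable densities -/

section LocalDensity

variable {Ω : Opens ℝ} {n : ℕ}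

/-- `g` is integrable with respect to `μ` on all compact subsets of `Ω`. -/
def LocIntegrable (Ω : Opens ℝ) (g : ℝ → ℂ) (μ : Measure ℝ) : Prop :=
  ∀ K : Set ℝ, IsCompact K → K ⊆ Ω → IntegrableOn g K μ

/-- `h dν` is a matrix of local measures on `Ω`. Both `coeffMeasure` and `weight` consist of such
data, which is all that the estimates below use. -/
structure IsLocalDensity (Ω : Opens ℝ) (ν : Measure ℝ) (h : ℝ → Matrix (Fin n) (Fin n) ℂ) :
    Prop where
  measurable : ∀ j k, Measurable fun x => h x j k
  locIntegrable : ∀ j k, LocIntegrable Ω (fun x => h x j k) ν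

/-- The default pair `(0, 0)` in the definition also qualifies, so both branches are covered. -/
theorem isLocalDensity_coeffMeasure (q : DistMatrix Ω n) :
    IsLocalDensity Ω (coeffMeasure q).1 (coeffMeasure q).2 := by
  unfold coeffMeasure
  split_ifs with H
  · exact ⟨H.choose_spec.measurable, fun j k K hK hKΩ => H.choose_spec.integrableOn K hK hKΩ j k⟩
  · exact ⟨fun _ _ => measurable_const, fun _ _ _ _ _ => by simp [IntegrableOn]⟩

theorem isLocalDensity_weight (w : DistMatrix Ω n) :
    IsLocalDensity Ω (weight w).S (weight w).W := by
  refine ⟨(weight w).measurable, ?_⟩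
  unfold weight
  split_ifs with H
  · exact fun j k K hK hKΩ => H.choose_spec.1.integrableOn K hK hKΩ j k
  · exact fun _ _ _ _ _ => by simp [IntegrableOn]

theorem weight_null_compl (w : DistMatrix Ω n) : (weight w).S (Ω : Set ℝ)ᶜ = 0 := by
  unfold weight
  split_ifs with H
  · exact H.choose_spec.1.null_compl
  · simp

/-- Bounded measurable real functions which vanish outside a compact subset of `Ω`. -/
structure IsCompactKernel (Ω : Opens ℝ) (k : ℝ → ℝ) : Prop where
  measurable : Measurable k
  bounded : ∃ B, ∀ x, |k x| ≤ B
  support : ∃ K : Set ℝ, IsCompact K ∧ K ⊆ Ω ∧ ∀ x ∉ K, k x = 0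

theorem LocIntegrable.integrable_mul {g : ℝ → ℂ} {μ : Measure ℝ} (hg : LocIntegrable Ω g μ)
    {k : ℝ → ℝ} (hk : IsCompactKernel Ω k) : Integrable (fun x => (k x : ℂ) * g x) μ := by
  obtain ⟨K, hK, hKΩ, hk0⟩ := hk.support
  obtain ⟨B, hB⟩ := hk.bounded
  have h1 : IntegrableOn (fun x => (k x : ℂ) * g x) K μ :=
    (hg K hK hKΩ).bdd_mul (c := B)
      (Complex.measurable_ofReal.comp hk.measurable).aestronglyMeasurable
      (Eventually.of_forall fun x => by simpa using hB x)
  exact h1.integrable_of_forall_notMem_eq_zero fun x hx => by simp [hk0 x hx]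

theorem isCompactKernel_indicator {K : Set ℝ} (hK : IsCompact K) (hKΩ : K ⊆ Ω) :
    IsCompactKernel Ω (K.indicator 1) :=
  ⟨measurable_one.indicator hK.measurableSet,
    ⟨1, fun x => by by_cases hx : x ∈ K <;> simp [hx]⟩, K, hK, hKΩ, fun x hx => by simp [hx]⟩

theorem isCompactKernel_testFunction {N : ℕ∞} (φ : 𝓓^{N}(Ω, ℝ)) : IsCompactKernel Ω φ := by
  obtain ⟨C, hC⟩ := φ.continuous.bounded_above_of_compact_support φ.hasCompactSupport
  exact ⟨φ.continuous.measurable, ⟨C, hC⟩, tsupport φ, φ.hasCompactSupport, φ.tsupport_subset,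
    fun x hx => image_eq_zero_of_notMem_tsupport hx⟩

theorem isCompactKernel_deriv (φ : 𝓓(Ω, ℝ)) : IsCompactKernel Ω (deriv φ) := by
  have hc : Continuous (deriv φ) := φ.contDiff.continuous_deriv (by simp)
  obtain ⟨C, hC⟩ := hc.bounded_above_of_compact_support φ.hasCompactSupport.deriv
  refine ⟨hc.measurable, ⟨C, hC⟩, tsupport φ, φ.hasCompactSupport, φ.tsupport_subset,
    fun x hx => ?_⟩
  by_contra h
  exact hx (support_deriv_subset h)

/-- The sum of the absolute values of the entries of a matrix. -/
noncomputable def entryNorm (A : Matrix (Fin n) (Fin n) ℂ) : ℝ := ∑ j, ∑ k, ‖A j k‖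

theorem entryNorm_nonneg (A : Matrix (Fin n) (Fin n) ℂ) : 0 ≤ entryNorm A :=
  Finset.sum_nonneg fun _ _ => Finset.sum_nonneg fun _ _ => norm_nonneg _

theorem norm_mulVec_le (A : Matrix (Fin n) (Fin n) ℂ) (u : Fin n → ℂ) :
    ‖A *ᵥ u‖ ≤ entryNorm A * ‖u‖ := by
  refine (pi_norm_le_iff_of_nonneg (mul_nonneg (entryNorm_nonneg A) (norm_nonneg u))).mpr ?_
  intro j
  calc ‖(A *ᵥ u) j‖ ≤ ∑ k, ‖A j k * u k‖ := norm_sum_le Finset.univ fun k => A j k * u k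
    _ ≤ ∑ k, ‖A j k‖ * ‖u‖ := Finset.sum_le_sum fun k _ => by
        rw [norm_mul]
        exact mul_le_mul_of_nonneg_left (norm_le_pi_norm u k) (norm_nonneg _)
    _ = (∑ k, ‖A j k‖) * ‖u‖ := (Finset.sum_mul _ _ _).symm
    _ ≤ entryNorm A * ‖u‖ := by
        refine mul_le_mul_of_nonneg_right ?_ (norm_nonneg u)
        exact Finset.single_le_sum (f := fun j => ∑ k, ‖A j k‖)
          (fun _ _ => Finset.sum_nonneg fun _ _ => norm_nonneg _) (Finset.mem_univ j)

theorem norm_mulVec_apply_le (A : Matrix (Fin n) (Fin n) ℂ) (u : Fin n → ℂ) (i : Fin n) :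
    ‖(A *ᵥ u) i‖ ≤ entryNorm A * ‖u‖ :=
  (norm_le_pi_norm _ i).trans (norm_mulVec_le A u)

/-- Functions which are Borel measurable on `Ω` and bounded on its compact subsets. -/
structure IsLocBounded (Ω : Opens ℝ) (u : ℝ → Fin n → ℂ) : Prop where
  measurable : Measurable ((Ω : Set ℝ).indicator u)
  bounded : ∀ K : Set ℝ, IsCompact K → K ⊆ Ω → ∃ C, 0 ≤ C ∧ ∀ x ∈ K, ‖u x‖ ≤ C

theorem IsLocalDensity.measurable_mulVec {ν : Measure ℝ} {h : ℝ → Matrix (Fin n) (Fin n) ℂ}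
    (hh : IsLocalDensity Ω ν h) {u : ℝ → Fin n → ℂ} (hu : Measurable u) (i : Fin n) :
    Measurable fun x => (h x *ᵥ u x) i := by
  simp only [mulVec, dotProduct]
  exact Finset.measurable_fun_sum _ fun k _ =>
    (hh.measurable i k).mul ((measurable_pi_apply k).comp hu)

theorem IsLocalDensity.integrableOn_entryNorm {ν : Measure ℝ}
    {h : ℝ → Matrix (Fin n) (Fin n) ℂ} (hh : IsLocalDensity Ω ν h) {K : Set ℝ} (hK : IsCompact K)
    (hKΩ : K ⊆ Ω) : IntegrableOn (fun x => entryNorm (h x)) K ν :=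
  integrable_finsetSum _ fun j _ => integrable_finsetSum _ fun k _ =>
    (hh.locIntegrable j k K hK hKΩ).norm

theorem IsLocalDensity.locIntegrable_mulVec {ν : Measure ℝ} {h : ℝ → Matrix (Fin n) (Fin n) ℂ}
    (hh : IsLocalDensity Ω ν h) {u : ℝ → Fin n → ℂ} (hu : IsLocBounded Ω u) (i : Fin n) :
    LocIntegrable Ω (fun x => (h x *ᵥ u x) i) ν := by
  intro K hK hKΩ
  obtain ⟨C, -, hC⟩ := hu.bounded K hK hKΩ
  refine ((hh.integrableOn_entryNorm hK hKΩ).mul_const C).mono' ?_ ?_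
  · refine (hh.measurable_mulVec hu.measurable i).aestronglyMeasurable.congr ?_
    filter_upwards [ae_restrict_mem hK.measurableSet] with x hx
    rw [Set.indicator_of_mem (hKΩ hx)]
  · filter_upwards [ae_restrict_mem hK.measurableSet] with x hx
    exact (norm_mulVec_apply_le _ _ i).trans
      (mul_le_mul_of_nonneg_left (hC x hx) (entryNorm_nonneg _))

theorem isLocalDensity_const (A : Matrix (Fin n) (Fin n) ℂ) :
    IsLocalDensity Ω volume fun _ => A :=
  ⟨fun _ _ => measurable_const, fun _ _ _ hK _ =>
    integrableOn_const (hK.measure_lt_top.ne)⟩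

end LocalDensity

/-! ### Compactly supported vectors in `𝓛²(w)` and elements of norm zero -/

namespace MatrixWeight

variable {Ω : Opens ℝ} {n : ℕ} {ω : MatrixWeight n}

theorem form_single (i : Fin n) (k : ℝ → ℝ) (f : ℝ → Fin n → ℂ) (x : ℝ) :
    ω.form (fun x => Pi.single i (k x : ℂ)) f x = (k x : ℂ) * (ω.W x *ᵥ f x) i := by
  simp only [form]
  rw [Pi.star_single, single_dotProduct]
  simp

/-- The form of `k eᵢ` with itself is `k² W i i`, a bounded compactly supported kernel times a
locally integrable density. -/
theorem memL2_single (hω : IsLocalDensity Ω ω.S ω.W) {k : ℝ → ℝ} (hk : IsCompactKernel Ω k)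
    (i : Fin n) : ω.MemL2 fun x => Pi.single i (k x : ℂ) := by
  refine ⟨?_, ?_⟩
  · refine Measurable.aestronglyMeasurable (measurable_pi_lambda _ fun j => ?_)
    by_cases hj : j = i
    · subst hj
      simpa using hk.measurable.complex_ofReal
    · simp [hj]
  · have hk2 : IsCompactKernel Ω fun x => k x * k x := by
      obtain ⟨B, hB⟩ := hk.bounded
      obtain ⟨K, hK, hKΩ, hk0⟩ := hk.support
      refine ⟨hk.measurable.mul hk.measurable, ⟨B * B, fun x => ?_⟩, K, hK, hKΩ, fun x hx => by
        simp [hk0 x hx]⟩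
      rw [abs_mul]
      exact mul_self_le_mul_self (abs_nonneg _) (hB x)
    refine ((hω.locIntegrable i i).integrable_mul hk2).congr (Eventually.of_forall fun x => ?_)
    simp only
    rw [form_single i]
    simp
    ring

/-- The element `k eᵢ` of `𝓛²(w)`. -/
def single (hω : IsLocalDensity Ω ω.S ω.W) {k : ℝ → ℝ} (hk : IsCompactKernel Ω k) (i : Fin n) :
    ω.L2Fun :=
  (⟨fun x => Pi.single i (k x : ℂ), memL2_single hω hk i⟩ : ω.l2Submodule)

/-- The right-hand side of the weak equation becomes an inner product, so Cauchy–Schwarz controls it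
by `‖f‖`. -/
theorem inner_single (hω : IsLocalDensity Ω ω.S ω.W) {k : ℝ → ℝ} (hk : IsCompactKernel Ω k)
    (i : Fin n) (f : ω.L2Fun) :
    inner ℂ (single hω hk i) f = ∫ x, (k x : ℂ) * (ω.W x *ᵥ f x) i ∂ω.S :=
  integral_congr_ae (Eventually.of_forall fun x => form_single i k f x)

/-- Although `f` need not be locally bounded, on `K` the function `(W f)ᵢ` is the form of `1_K eᵢ`
and `f`, both in `𝓛²(w)`. -/
theorem locIntegrable_mulVec (hω : IsLocalDensity Ω ω.S ω.W) (f : ω.L2Fun) (i : Fin n) :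
    LocIntegrable Ω (fun x => (ω.W x *ᵥ f x) i) ω.S := by
  intro K hK hKΩ
  have hk := isCompactKernel_indicator hK hKΩ
  have h : Integrable (ω.form (single hω hk i) f) ω.S := (memL2_single hω hk i).integrable_form f.2
  refine h.integrableOn.congr_fun (fun x hx => ?_) hK.measurableSet
  refine (form_single i _ f x).trans ?_
  simp [hx]

theorem norm_sq_L2Fun (f : ω.L2Fun) : ((‖f‖ ^ 2 : ℝ) : ℂ) = ∫ x, ω.form f f x ∂ω.S := by
  rw [← inner_L2Fun, inner_self_eq_norm_sq_to_K]
  norm_cast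

theorem mulVec_eq_zero_of_form_eq_zero {f : ℝ → Fin n → ℂ} {x : ℝ} (h : ω.form f f x = 0) :
    ω.W x *ᵥ f x = 0 := by
  have := (Matrix.PosSemidef.dotProduct_mulVec_zero_iff (ω.posSemidef x) (f x)).mp h
  exact this

/-- For positive semidefinite `W`, `f* W f = 0` forces `W f = 0`. Hence a class in `L²(w)` is the
same thing as `W f` up to null sets. -/
theorem norm_eq_zero_iff_ae (f : ω.L2Fun) :
    ‖f‖ = 0 ↔ ∀ᵐ x ∂ω.S, ω.W x *ᵥ f x = 0 := by
  have hre : ‖f‖ ^ 2 = ∫ x, (ω.form f f x).re ∂ω.S := by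
    have h := congrArg Complex.re (norm_sq_L2Fun f)
    have h2 : (∫ x, ω.form f f x ∂ω.S).re = ∫ x, (ω.form f f x).re ∂ω.S :=
      (integral_re f.2.2).symm
    rw [← h2, ← h, Complex.ofReal_re]
  have h0 : ∀ x, 0 ≤ (ω.form f f x).re := fun x =>
    (Complex.le_def.mp (ω.form_self_nonneg f x)).1
  rw [← sq_eq_zero_iff, hre, integral_eq_zero_iff_of_nonneg h0 f.2.2.re]
  refine ⟨fun h => ?_, fun h => ?_⟩
  · filter_upwards [h] with x hx
    refine mulVec_eq_zero_of_form_eq_zero (Complex.ext hx ?_)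
    exact (Complex.le_def.mp (ω.form_self_nonneg f x)).2.symm
  · filter_upwards [h] with x hx
    simp [form, hx]

theorem toL2_add (f g : ω.L2Fun) : ω.toL2 (f + g) = ω.toL2 f + ω.toL2 g := rfl

theorem toL2_sub (f g : ω.L2Fun) : ω.toL2 (f - g) = ω.toL2 f - ω.toL2 g := rfl

theorem toL2_smul (c : ℂ) (f : ω.L2Fun) : ω.toL2 (c • f) = c • ω.toL2 f := rfl

theorem norm_toL2 (f : ω.L2Fun) : ‖ω.toL2 f‖ = ‖f‖ := SeparationQuotient.norm_mk f

theorem inner_toL2 (f g : ω.L2Fun) : inner ℂ (ω.toL2 f) (ω.toL2 g) = inner ℂ f g :=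
  SeparationQuotient.inner_mk_mk f g

theorem toL2_surjective : Function.Surjective ω.toL2 := SeparationQuotient.surjective_mk

theorem toL2_eq_zero_iff (f : ω.L2Fun) :
    ω.toL2 f = 0 ↔ ∀ᵐ x ∂ω.S, ω.W x *ᵥ f x = 0 := by
  rw [← norm_eq_zero_iff_ae, ← norm_toL2, norm_eq_zero]

end MatrixWeight

/-! ### Measurability and local boundedness of functions of bounded variation -/

section BoundedVariation

variable {Ω : Opens ℝ} {n : ℕ}

/-- On `s`, the set where `f > c` is cut out by an upper set of the line, which is order connected
and hence measurable. -/
theorem measurable_indicator_of_monotoneOn {s : Set ℝ} (hs : MeasurableSet s) {f : ℝ → ℝ}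
    (hf : MonotoneOn f s) : Measurable (s.indicator f) := by
  refine measurable_of_Ioi fun c => ?_
  have hU : MeasurableSet {x | ∃ y ∈ s, y ≤ x ∧ c < f y} := by
    refine Set.OrdConnected.measurableSet (IsUpperSet.ordConnected ?_)
    rintro a b hab ⟨y, hy, hya, hc⟩
    exact ⟨y, hy, hya.trans hab, hc⟩
  have heq : s.indicator f ⁻¹' Set.Ioi c =
      (s ∩ {x | ∃ y ∈ s, y ≤ x ∧ c < f y}) ∪ (sᶜ ∩ {_x | c < 0}) := by
    ext x
    by_cases hx : x ∈ s
    · simp only [Set.mem_preimage, Set.indicator_of_mem hx, Set.mem_Ioi, Set.mem_union,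
        Set.mem_inter_iff, hx, true_and, Set.mem_compl_iff, not_true, false_and, or_false]
      exact ⟨fun h => ⟨x, hx, le_rfl, h⟩, fun ⟨y, hy, hyx, h⟩ => h.trans_le (hf hy hx hyx)⟩
    · simp [hx]
  rw [heq]
  exact (hs.inter hU).union (hs.compl.inter (MeasurableSet.const _))

theorem LocallyBoundedVariationOn.measurable_indicator {s : Set ℝ} (hs : MeasurableSet s)
    {f : ℝ → ℝ} (hf : LocallyBoundedVariationOn f s) : Measurable (s.indicator f) := by
  obtain ⟨p, q, hp, hq, rfl⟩ := hf.exists_monotoneOn_sub_monotoneOn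
  rw [Set.indicator_sub']
  exact (measurable_indicator_of_monotoneOn hs hp).sub (measurable_indicator_of_monotoneOn hs hq)

theorem IsBalancedBV.isLocBounded {u : ℝ → Fin n → ℂ} (hu : IsBalancedBV Ω u) :
    IsLocBounded Ω u := by
  have hs : MeasurableSet (Ω : Set ℝ) := Ω.isOpen.measurableSet
  refine ⟨measurable_pi_lambda _ fun i => ?_, fun K hK hKΩ => ?_⟩
  · have hre : LocallyBoundedVariationOn (fun x => (u x i).re) (Ω : Set ℝ) := by
      have hl : LipschitzWith 1 fun v : Fin n → ℂ => (v i).re :=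
        LipschitzWith.of_dist_le_mul fun v w => by
          rw [NNReal.coe_one, one_mul, Real.dist_eq, ← Complex.sub_re, dist_eq_norm]
          exact (Complex.abs_re_le_norm _).trans (norm_le_pi_norm (v - w) i)
      exact hl.comp_locallyBoundedVariationOn hu.1
    have him : LocallyBoundedVariationOn (fun x => (u x i).im) (Ω : Set ℝ) := by
      have hl : LipschitzWith 1 fun v : Fin n → ℂ => (v i).im :=
        LipschitzWith.of_dist_le_mul fun v w => by
          rw [NNReal.coe_one, one_mul, Real.dist_eq, ← Complex.sub_im, dist_eq_norm]
          exact (Complex.abs_im_le_norm _).trans (norm_le_pi_norm (v - w) i)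
      exact hl.comp_locallyBoundedVariationOn hu.1
    have h1 := Complex.measurable_ofReal.comp
      (LocallyBoundedVariationOn.measurable_indicator hs hre)
    have h2 := Complex.measurable_ofReal.comp
      (LocallyBoundedVariationOn.measurable_indicator hs him)
    convert h1.add (h2.mul_const Complex.I) using 1
    funext x
    by_cases hx : x ∈ (Ω : Set ℝ) <;> simp [hx, Complex.re_add_im]
  · rcases K.eq_empty_or_nonempty with rfl | hne
    · exact ⟨0, le_rfl, by simp⟩
    · have hm := hK.sInf_mem hne
      have hM := hK.sSup_mem hne
      have hv := hu.1 _ _ (hKΩ hm) (hKΩ hM)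
      refine ⟨‖u (sInf K)‖ + (eVariationOn u (Ω ∩ Set.Icc (sInf K) (sSup K))).toReal,
        by positivity, fun x hx => ?_⟩
      have hxm : sInf K ≤ x := csInf_le hK.bddBelow hx
      have hxM : x ≤ sSup K := le_csSup hK.bddAbove hx
      have hd := BoundedVariationOn.dist_le hv ⟨hKΩ hx, hxm, hxM⟩ ⟨hKΩ hm, le_rfl, hxm.trans hxM⟩
      have := norm_sub_norm_le (u x) (u (sInf K))
      rw [dist_eq_norm] at hd
      linarith

end BoundedVariation

/-! ### Smooth approximations of indicator functions -/

section Kernel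

/-- The Heaviside function with value `1 / 2` at `0`. -/
noncomputable def heaviside (y : ℝ) : ℝ := if y < 0 then 0 else if y = 0 then 1 / 2 else 1

/-- The signed indicator function of the interval between `s` and `t`, with half weights at its
end points. -/
noncomputable def jumpKernel (s t x : ℝ) : ℝ := heaviside (x - s) - heaviside (x - t)

/-- A smooth version of the Heaviside function. -/
noncomputable def smoothStep (y : ℝ) : ℝ := Real.smoothTransition ((y + 1) / 2)

theorem heaviside_of_neg {y : ℝ} (hy : y < 0) : heaviside y = 0 := if_pos hy

theorem heaviside_of_pos {y : ℝ} (hy : 0 < y) : heaviside y = 1 := by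
  rw [heaviside, if_neg hy.le.not_gt, if_neg hy.ne']

theorem heaviside_zero : heaviside 0 = 1 / 2 := by simp [heaviside]

theorem heaviside_mem_Icc (y : ℝ) : heaviside y ∈ Set.Icc (0 : ℝ) 1 := by
  unfold heaviside
  split_ifs <;> norm_num

theorem measurable_heaviside : Measurable heaviside :=
  Measurable.ite measurableSet_Iio measurable_const
    (Measurable.ite (measurableSet_singleton 0) measurable_const measurable_const)

theorem measurable_jumpKernel (s t : ℝ) : Measurable (jumpKernel s t) :=
  (measurable_heaviside.comp (measurable_id.sub_const s)).sub
    (measurable_heaviside.comp (measurable_id.sub_const t))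

theorem abs_jumpKernel_le (s t x : ℝ) : |jumpKernel s t x| ≤ 1 := by
  have h1 := heaviside_mem_Icc (x - s)
  have h2 := heaviside_mem_Icc (x - t)
  rw [Set.mem_Icc] at h1 h2
  rw [jumpKernel, abs_le]
  constructor <;> linarith

theorem jumpKernel_add (r s t x : ℝ) :
    jumpKernel r s x + jumpKernel s t x = jumpKernel r t x := by
  simp [jumpKernel]

theorem jumpKernel_eq_zero {a b s t x : ℝ} (hs : s ∈ Set.Icc a b) (ht : t ∈ Set.Icc a b)
    (hx : x ∉ Set.Icc a b) : jumpKernel s t x = 0 := by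
  rw [Set.mem_Icc, not_and_or, not_le, not_le] at hx
  unfold jumpKernel
  rcases hx with hx | hx
  · rw [heaviside_of_neg (by linarith [hs.1]), heaviside_of_neg (by linarith [ht.1]), sub_self]
  · rw [heaviside_of_pos (by linarith [hs.2]), heaviside_of_pos (by linarith [ht.2]), sub_self]

theorem jumpKernel_nonneg {s t : ℝ} (hst : s ≤ t) (x : ℝ) : 0 ≤ jumpKernel s t x := by
  unfold jumpKernel heaviside
  split_ifs <;> first | (norm_num; done) | (exfalso; grind)

theorem isCompactKernel_jumpKernel {Ω : Opens ℝ} (hΩ : (Ω : Set ℝ).OrdConnected) {s t : ℝ}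
    (hs : s ∈ Ω) (ht : t ∈ Ω) : IsCompactKernel Ω (jumpKernel s t) :=
  ⟨measurable_jumpKernel s t, ⟨1, abs_jumpKernel_le s t⟩, Set.uIcc s t, isCompact_uIcc,
    hΩ.uIcc_subset hs ht, fun _ hx => jumpKernel_eq_zero Set.left_mem_uIcc Set.right_mem_uIcc hx⟩

theorem contDiff_smoothStep {N : ℕ∞} : ContDiff ℝ N smoothStep :=
  Real.smoothTransition.contDiff.comp ((contDiff_id.add contDiff_const).div_const 2)

theorem smoothStep_of_le {y : ℝ} (hy : y ≤ -1) : smoothStep y = 0 :=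
  Real.smoothTransition.zero_of_nonpos (by linarith)

theorem smoothStep_of_ge {y : ℝ} (hy : 1 ≤ y) : smoothStep y = 1 :=
  Real.smoothTransition.one_of_one_le (by linarith)

/-- By symmetry of the transition each half of the peak `deriv smoothStep` has mass `1 / 2`. This
produces the mean of the one-sided limits and the half weights at end points. -/
theorem smoothStep_zero : smoothStep 0 = 1 / 2 := by
  have h : Real.smoothTransition (1 / 2) = 1 / 2 := by
    have h0 : 0 < expNegInvGlue (1 / 2) := expNegInvGlue.pos_of_pos (by norm_num)
    unfold Real.smoothTransition
    rw [show (1 : ℝ) - 1 / 2 = 1 / 2 by norm_num]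
    field_simp
    norm_num
  simpa [smoothStep] using h

theorem smoothStep_mem_Icc (y : ℝ) : smoothStep y ∈ Set.Icc (0 : ℝ) 1 :=
  ⟨Real.smoothTransition.nonneg _, Real.smoothTransition.le_one _⟩

theorem continuous_deriv_smoothStep : Continuous (deriv smoothStep) :=
  (contDiff_smoothStep (N := 1)).continuous_deriv (by simp)

theorem hasDerivAt_smoothStep (y : ℝ) : HasDerivAt smoothStep (deriv smoothStep y) y :=
  ((contDiff_smoothStep (N := 1)).differentiable (by simp) y).hasDerivAt

theorem deriv_smoothStep_eq_zero {y : ℝ} (hy : 1 < |y|) : deriv smoothStep y = 0 := by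
  rcases lt_abs.mp hy with h | h
  · have : smoothStep =ᶠ[𝓝 y] fun _ => 1 := by
      filter_upwards [Ioi_mem_nhds h] with z hz using smoothStep_of_ge (le_of_lt hz)
    rw [this.deriv_eq, deriv_const]
  · have : smoothStep =ᶠ[𝓝 y] fun _ => 0 := by
      filter_upwards [Iio_mem_nhds (show y < -1 by linarith)] with z hz using
        smoothStep_of_le (le_of_lt hz)
    rw [this.deriv_eq, deriv_const]

theorem hasCompactSupport_deriv_smoothStep : HasCompactSupport (deriv smoothStep) :=
  HasCompactSupport.of_support_subset_isCompact (isCompact_Icc (a := (-1 : ℝ)) (b := 1))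
    fun y hy => by
      by_contra h
      refine hy (deriv_smoothStep_eq_zero ?_)
      exact not_le.mp fun h1 => h (abs_le.mp h1)

theorem integrable_deriv_smoothStep : Integrable (deriv smoothStep) :=
  continuous_deriv_smoothStep.integrable_of_hasCompactSupport hasCompactSupport_deriv_smoothStep

theorem integral_Iic_deriv_smoothStep : ∫ y in Set.Iic 0, deriv smoothStep y = 1 / 2 := by
  have h := integral_Iic_of_hasDerivAt_of_tendsto' (a := (0 : ℝ)) (m := (0 : ℝ))
    (fun y _ => hasDerivAt_smoothStep y) integrable_deriv_smoothStep.integrableOn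
    (tendsto_const_nhds.congr' (by
      filter_upwards [eventually_le_atBot (-1 : ℝ)] with y hy using (smoothStep_of_le hy).symm))
  rw [h, smoothStep_zero, sub_zero]

theorem integral_Ioi_deriv_smoothStep : ∫ y in Set.Ioi 0, deriv smoothStep y = 1 / 2 := by
  have h := integral_Ioi_of_hasDerivAt_of_tendsto' (a := (0 : ℝ)) (m := (1 : ℝ))
    (fun y _ => hasDerivAt_smoothStep y) integrable_deriv_smoothStep.integrableOn
    (tendsto_const_nhds.congr' (by
      filter_upwards [eventually_ge_atTop (1 : ℝ)] with y hy using (smoothStep_of_ge hy).symm))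
  rw [h, smoothStep_zero]
  norm_num

theorem tendsto_smoothStep_div (y : ℝ) :
    Tendsto (fun ε : ℝ => smoothStep (y / ε)) (𝓝[>] 0) (𝓝 (heaviside y)) := by
  rcases lt_trichotomy y 0 with hy | rfl | hy
  · rw [heaviside_of_neg hy]
    refine tendsto_const_nhds.congr' ?_
    filter_upwards [Ioo_mem_nhdsGT (neg_pos.mpr hy)] with ε hε
    refine (smoothStep_of_le ?_).symm
    rw [div_le_iff₀ hε.1]
    linarith [hε.2]
  · simp only [zero_div, smoothStep_zero, heaviside_zero]
    exact tendsto_const_nhds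
  · rw [heaviside_of_pos hy]
    refine tendsto_const_nhds.congr' ?_
    filter_upwards [Ioo_mem_nhdsGT hy] with ε hε
    refine (smoothStep_of_ge ?_).symm
    rw [le_div_iff₀ hε.1]
    linarith [hε.2]

/-- Averages of a function against smooth symmetric peaks at `s` converge to the mean of its
one-sided limits. -/
theorem tendsto_integral_deriv_smoothStep {F : ℝ → ℂ} (hF : Measurable F) {s δ C : ℝ} (hδ : 0 < δ)
    (hC : ∀ x ∈ Set.Icc (s - δ) (s + δ), ‖F x‖ ≤ C) {l r : ℂ}
    (hl : Tendsto F (𝓝[<] s) (𝓝 l)) (hr : Tendsto F (𝓝[>] s) (𝓝 r)) :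
    Tendsto (fun ε : ℝ => ∫ x, ((ε⁻¹ * deriv smoothStep ((x - s) / ε) : ℝ) : ℂ) * F x)
      (𝓝[>] 0) (𝓝 ((1 / 2 : ℂ) * (r + l))) := by
  -- The substitution `x = s + ε y` moves the scaling from the peak to `F`, making dominated
  -- convergence applicable.
  have hsub : ∀ ε : ℝ, 0 < ε → ∫ y, ((deriv smoothStep y : ℝ) : ℂ) * F (s + ε * y) =
      ∫ x, ((ε⁻¹ * deriv smoothStep ((x - s) / ε) : ℝ) : ℂ) * F x := by
    intro ε hε
    have h1 := Measure.integral_comp_mul_left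
      (fun z => ((ε⁻¹ * deriv smoothStep (z / ε) : ℝ) : ℂ) * F (s + z)) ε
    have h2 := integral_add_left_eq_self (μ := volume)
      (fun x => ((ε⁻¹ * deriv smoothStep ((x - s) / ε) : ℝ) : ℂ) * F x) s
    rw [← h2]
    simp only [add_sub_cancel_left]
    rw [abs_of_pos (inv_pos.mpr hε)] at h1
    have h3 : (fun y => ((ε⁻¹ * deriv smoothStep (ε * y / ε) : ℝ) : ℂ) * F (s + ε * y)) =
        fun y => (ε⁻¹ : ℂ) * (((deriv smoothStep y : ℝ) : ℂ) * F (s + ε * y)) := by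
      funext y
      rw [mul_div_cancel_left₀ y hε.ne']
      push_cast
      ring
    rw [h3, integral_const_mul, Complex.real_smul, Complex.ofReal_inv] at h1
    have hne : (ε : ℂ)⁻¹ ≠ 0 := inv_ne_zero (by exact_mod_cast hε.ne')
    exact mul_left_cancel₀ hne h1
  -- As `ε` decreases to zero, `F (s + ε y)` tends to `l` for `y < 0` and to `r` for `y > 0`. The
  -- value at `y = 0` does not matter.
  have hlimit : ∫ y, ((deriv smoothStep y : ℝ) : ℂ) * (if y ≤ 0 then l else r) =
      (1 / 2 : ℂ) * (r + l) := by
    have hi1 : IntegrableOn (fun y => ((deriv smoothStep y : ℝ) : ℂ) * (if y ≤ 0 then l else r))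
        (Set.Iic 0) := by
      refine ((integrable_deriv_smoothStep.ofReal (𝕜 := ℂ)).mul_const l).integrableOn.congr_fun
        (fun y hy => ?_) measurableSet_Iic
      simp only [if_pos (show y ≤ 0 from hy)]; rfl
    have hi2 : IntegrableOn (fun y => ((deriv smoothStep y : ℝ) : ℂ) * (if y ≤ 0 then l else r))
        (Set.Ioi 0) := by
      refine ((integrable_deriv_smoothStep.ofReal (𝕜 := ℂ)).mul_const r).integrableOn.congr_fun
        (fun y hy => ?_) measurableSet_Ioi
      simp only [if_neg (not_le.mpr (show 0 < y from hy))]; rfl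
    rw [← intervalIntegral.integral_Iic_add_Ioi hi1 hi2]
    have e1 : ∫ y in Set.Iic 0, ((deriv smoothStep y : ℝ) : ℂ) * (if y ≤ 0 then l else r) =
        ∫ y in Set.Iic 0, ((deriv smoothStep y : ℝ) : ℂ) * l :=
      setIntegral_congr_fun measurableSet_Iic fun y hy => by
        simp only [if_pos (show y ≤ 0 from hy)]
    have e2 : ∫ y in Set.Ioi 0, ((deriv smoothStep y : ℝ) : ℂ) * (if y ≤ 0 then l else r) =
        ∫ y in Set.Ioi 0, ((deriv smoothStep y : ℝ) : ℂ) * r :=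
      setIntegral_congr_fun measurableSet_Ioi fun y hy => by
        simp only [if_neg (not_le.mpr (show 0 < y from hy))]
    rw [e1, e2, integral_mul_const, integral_mul_const, integral_complex_ofReal,
      integral_complex_ofReal, integral_Iic_deriv_smoothStep, integral_Ioi_deriv_smoothStep]
    push_cast
    ring
  rw [← hlimit]
  refine Tendsto.congr' (eventually_nhdsWithin_of_forall hsub) ?_
  refine tendsto_integral_filter_of_dominated_convergence
    (fun y => |deriv smoothStep y| * C) ?_ ?_ (integrable_deriv_smoothStep.abs.mul_const C) ?_
  · refine Eventually.of_forall fun ε => Measurable.aestronglyMeasurable ?_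
    exact continuous_deriv_smoothStep.measurable.complex_ofReal.mul
      (hF.comp ((measurable_id.const_mul ε).const_add s))
  · filter_upwards [Ioo_mem_nhdsGT hδ] with ε hε
    refine Eventually.of_forall fun y => ?_
    rw [norm_mul, Complex.norm_real, Real.norm_eq_abs]
    by_cases hy : 1 < |y|
    · simp [deriv_smoothStep_eq_zero hy]
    · refine mul_le_mul_of_nonneg_left (hC _ ?_) (abs_nonneg _)
      have h1 : |ε * y| ≤ δ := by
        rw [abs_mul, abs_of_pos hε.1]
        nlinarith [hε.1, hε.2, abs_nonneg y, not_lt.mp hy]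
      rw [abs_le] at h1
      exact ⟨by linarith [h1.1], by linarith [h1.2]⟩
  · have hne : ∀ᵐ y : ℝ, y ≠ 0 := by
      simp [ae_iff, measure_singleton]
    filter_upwards [hne] with y hy
    refine Tendsto.const_mul _ ?_
    have hc : Tendsto (fun ε : ℝ => s + ε * y) (𝓝[>] 0) (𝓝 s) := by
      have : Continuous fun ε : ℝ => s + ε * y := by fun_prop
      have h := this.tendsto 0
      simp only [zero_mul, add_zero] at h
      exact h.mono_left nhdsWithin_le_nhds
    rcases lt_or_gt_of_ne hy with hy | hy
    · rw [if_pos hy.le]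
      refine hl.comp (tendsto_nhdsWithin_iff.mpr ⟨hc, ?_⟩)
      filter_upwards [self_mem_nhdsWithin] with ε hε
      have : ε * y < 0 := mul_neg_of_pos_of_neg hε hy
      simpa using this
    · rw [if_neg hy.not_ge]
      refine hr.comp (tendsto_nhdsWithin_iff.mpr ⟨hc, ?_⟩)
      filter_upwards [self_mem_nhdsWithin] with ε hε
      have : 0 < ε * y := mul_pos hε hy
      simpa using this

/-- The smooth approximation of `jumpKernel s t` of width `ε`. -/
noncomputable def smoothKernel (s t ε x : ℝ) : ℝ :=
  smoothStep ((x - s) / ε) - smoothStep ((x - t) / ε)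

theorem contDiff_smoothKernel (s t ε : ℝ) {N : ℕ∞} : ContDiff ℝ N (smoothKernel s t ε) :=
  (contDiff_smoothStep.comp ((contDiff_id.sub contDiff_const).div_const ε)).sub
    (contDiff_smoothStep.comp ((contDiff_id.sub contDiff_const).div_const ε))

theorem deriv_smoothKernel (s t ε x : ℝ) : deriv (smoothKernel s t ε) x =
    ε⁻¹ * deriv smoothStep ((x - s) / ε) - ε⁻¹ * deriv smoothStep ((x - t) / ε) := by
  have h : ∀ c : ℝ, HasDerivAt (fun x => smoothStep ((x - c) / ε))
      (ε⁻¹ * deriv smoothStep ((x - c) / ε)) x := by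
    intro c
    have h1 : HasDerivAt (fun x : ℝ => (x - c) / ε) ε⁻¹ x := by
      simpa [div_eq_mul_inv] using ((hasDerivAt_id x).sub_const c).div_const ε
    rw [mul_comm]
    exact (hasDerivAt_smoothStep _).comp x h1
  exact ((h s).sub (h t)).deriv

theorem abs_smoothKernel_le (s t ε x : ℝ) : |smoothKernel s t ε x| ≤ 1 := by
  have h1 := smoothStep_mem_Icc ((x - s) / ε)
  have h2 := smoothStep_mem_Icc ((x - t) / ε)
  rw [Set.mem_Icc] at h1 h2
  rw [smoothKernel, abs_le]
  constructor <;> linarith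

theorem smoothKernel_eq_zero {a b s t ε x : ℝ} (hε : 0 < ε) (hs : s ∈ Set.Icc a b)
    (ht : t ∈ Set.Icc a b) (hx : x ∉ Set.Icc (a - ε) (b + ε)) : smoothKernel s t ε x = 0 := by
  rw [Set.mem_Icc, not_and_or, not_le, not_le] at hx
  have h1 := hs.1; have h2 := hs.2; have h3 := ht.1; have h4 := ht.2
  unfold smoothKernel
  rcases hx with hx | hx
  · rw [smoothStep_of_le, smoothStep_of_le, sub_self] <;> rw [div_le_iff₀ hε] <;> linarith
  · rw [smoothStep_of_ge, smoothStep_of_ge, sub_self] <;> rw [le_div_iff₀ hε] <;> linarith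

theorem tendsto_smoothKernel (s t x : ℝ) :
    Tendsto (fun ε => smoothKernel s t ε x) (𝓝[>] 0) (𝓝 (jumpKernel s t x)) :=
  (tendsto_smoothStep_div _).sub (tendsto_smoothStep_div _)

end Kernel

/-! ### The integral equation -/

section IntegralEquation

variable {Ω : Opens ℝ} {n : ℕ}

theorem exists_thickening (hΩ : (Ω : Set ℝ).OrdConnected) {s t : ℝ} (hs : s ∈ Ω) (ht : t ∈ Ω) :
    ∃ a b δ : ℝ, 0 < δ ∧ s ∈ Set.Icc a b ∧ t ∈ Set.Icc a b ∧ Set.Icc (a - δ) (b + δ) ⊆ Ω := by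
  have hmin : min s t ∈ Ω := by rcases min_choice s t with h | h <;> rw [h] <;> assumption
  have hmax : max s t ∈ Ω := by rcases max_choice s t with h | h <;> rw [h] <;> assumption
  obtain ⟨δ₁, hδ₁, h₁⟩ := Metric.isOpen_iff.mp Ω.isOpen _ hmin
  obtain ⟨δ₂, hδ₂, h₂⟩ := Metric.isOpen_iff.mp Ω.isOpen _ hmax
  refine ⟨min s t, max s t, min δ₁ δ₂ / 2, by positivity, ⟨min_le_left _ _, le_max_left _ _⟩,
    ⟨min_le_right _ _, le_max_right _ _⟩, hΩ.out (h₁ ?_) (h₂ ?_)⟩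
  · rw [Metric.mem_ball, Real.dist_eq, sub_sub_cancel_left, abs_neg, abs_of_pos (by positivity)]
    have := min_le_left δ₁ δ₂
    linarith
  · rw [Metric.mem_ball, Real.dist_eq, add_sub_cancel_left, abs_of_pos (by positivity)]
    have := min_le_right δ₁ δ₂
    linarith

/-- Dominated convergence on a fixed compact neighbourhood. The kernels converge at every point, end
points included, which is essential because `μ` may have atoms there. -/
theorem LocIntegrable.tendsto_integral_smoothKernel {g : ℝ → ℂ} {μ : Measure ℝ}
    (hg : LocIntegrable Ω g μ) (hΩ : (Ω : Set ℝ).OrdConnected) {s t : ℝ} (hs : s ∈ Ω)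
    (ht : t ∈ Ω) :
    Tendsto (fun ε => ∫ x, (smoothKernel s t ε x : ℂ) * g x ∂μ) (𝓝[>] 0)
      (𝓝 (∫ x, (jumpKernel s t x : ℂ) * g x ∂μ)) := by
  obtain ⟨a, b, δ, hδ, hsab, htab, hsub⟩ := exists_thickening hΩ hs ht
  have hK : IsCompact (Set.Icc (a - δ) (b + δ)) := isCompact_Icc
  have hgi := hg _ hK hsub
  have hzero : ∀ ε ∈ Set.Ioo 0 δ, ∀ x ∉ Set.Icc (a - δ) (b + δ), smoothKernel s t ε x = 0 :=
    fun ε hε x hx => smoothKernel_eq_zero hε.1 hsab htab fun hx' =>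
      hx ⟨by linarith [hx'.1, hε.2], by linarith [hx'.2, hε.2]⟩
  have hzero' : ∀ x ∉ Set.Icc (a - δ) (b + δ), jumpKernel s t x = 0 := fun x hx =>
    jumpKernel_eq_zero hsab htab fun hx' => hx ⟨by linarith [hx'.1], by linarith [hx'.2]⟩
  rw [← setIntegral_eq_integral_of_forall_compl_eq_zero (s := Set.Icc (a - δ) (b + δ))
    fun x hx => by simp [hzero' x hx]]
  refine Tendsto.congr' (f₁ := fun ε => ∫ x in Set.Icc (a - δ) (b + δ),
    (smoothKernel s t ε x : ℂ) * g x ∂μ) ?_ ?_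
  · filter_upwards [Ioo_mem_nhdsGT hδ] with ε hε
    exact setIntegral_eq_integral_of_forall_compl_eq_zero fun x hx => by simp [hzero ε hε x hx]
  · refine tendsto_integral_filter_of_dominated_convergence (fun x => ‖g x‖) ?_ ?_ hgi.norm ?_
    · refine Eventually.of_forall fun ε => ?_
      exact ((contDiff_smoothKernel s t ε (N := 0)).continuous.measurable.complex_ofReal
        ).aestronglyMeasurable.mul hgi.aestronglyMeasurable
    · refine Eventually.of_forall fun ε => Eventually.of_forall fun x => ?_
      rw [norm_mul, Complex.norm_real, Real.norm_eq_abs]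
      exact mul_le_of_le_one_left (norm_nonneg _) (abs_smoothKernel_le _ _ _ _)
    · refine Eventually.of_forall fun x => ?_
      exact ((Complex.continuous_ofReal.tendsto _).comp (tendsto_smoothKernel s t x)).mul_const _

/-- The equation is tested with `smoothKernel s t ε`. Its derivative is a peak at `s` minus a peak
at `t`, so balancedness of `u` yields `J u(s) - J u(t)` as `ε` tends to zero. -/
theorem integral_equation (hΩ : (Ω : Set ℝ).OrdConnected) {J : Matrix (Fin n) (Fin n) ℂ}
    {q w : DistMatrix Ω n} {u : ℝ → Fin n → ℂ} (f : (weight w).L2Fun) (hu : IsBalancedBV Ω u)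
    (hsol : IsSolution J q w u f) {s t : ℝ} (hs : s ∈ Ω) (ht : t ∈ Ω) (i : Fin n) :
    (J *ᵥ u t) i - (J *ᵥ u s) i =
      -(∫ x, (jumpKernel s t x : ℂ) * ((coeffMeasure q).2 x *ᵥ u x) i ∂(coeffMeasure q).1) +
        ∫ x, (jumpKernel s t x : ℂ) * ((weight w).W x *ᵥ f x) i ∂(weight w).S := by
  have hub := hu.isLocBounded
  have hq := (isLocalDensity_coeffMeasure q).locIntegrable_mulVec hub i
  have hw := MatrixWeight.locIntegrable_mulVec (isLocalDensity_weight w) f i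
  obtain ⟨a, b, δ, hδ, hsab, htab, hsub⟩ := exists_thickening hΩ hs ht
  -- Cutting `u` off outside `Ω`, where nothing is known about it, makes the integrand measurable on
  -- the whole line.
  set F : ℝ → ℂ := fun x => (J *ᵥ (Ω : Set ℝ).indicator u x) i with hF
  have hFm : Measurable F := (isLocalDensity_const (Ω := Ω) J).measurable_mulVec hub.measurable i
  have hFu : ∀ x ∈ Ω, F x = (J *ᵥ u x) i := fun x hx => by
    rw [hF]; simp only; rw [Set.indicator_of_mem (by exact hx)]
  obtain ⟨C, hC0, hC⟩ := hub.bounded _ isCompact_Icc hsub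
  have hpeak : ∀ p ∈ Set.Icc a b, Tendsto
      (fun ε : ℝ => ∫ x, ((ε⁻¹ * deriv smoothStep ((x - p) / ε) : ℝ) : ℂ) * F x)
      (𝓝[>] 0) (𝓝 ((J *ᵥ u p) i)) := by
    intro p hp
    have hpI : Set.Icc (p - δ) (p + δ) ⊆ Set.Icc (a - δ) (b + δ) :=
      Set.Icc_subset_Icc (by linarith [hp.1]) (by linarith [hp.2])
    have hpΩ : p ∈ Ω := hsub (hpI ⟨by linarith, by linarith⟩)
    obtain ⟨l, r, hl, hr, hlr⟩ := hu.2 p hpΩ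
    have hcont : Continuous fun v : Fin n → ℂ => (J *ᵥ v) i :=
      (continuous_apply i).comp (J.mulVecLin.continuous_of_finiteDimensional)
    have hev : (fun x => (J *ᵥ u x) i) =ᶠ[𝓝 p] F := by
      filter_upwards [Ω.isOpen.mem_nhds hpΩ] with x hx using (hFu x hx).symm
    have h := tendsto_integral_deriv_smoothStep hFm (s := p) (C := entryNorm J * C) hδ
      (fun x hx => ?_)
      (((hcont.tendsto l).comp hl).congr' (hev.filter_mono nhdsWithin_le_nhds))
      (((hcont.tendsto r).comp hr).congr' (hev.filter_mono nhdsWithin_le_nhds))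
    · convert h using 2
      rw [hlr, mulVec_smul, mulVec_add]
      rfl
    · rw [hFu x (hsub (hpI hx))]
      exact (norm_mulVec_apply_le _ _ i).trans
        (mul_le_mul_of_nonneg_left (hC x (hpI hx)) (entryNorm_nonneg _))
  have hpint : ∀ p ∈ Set.Icc a b, ∀ ε ∈ Set.Ioo 0 δ,
      Integrable fun x => ((ε⁻¹ * deriv smoothStep ((x - p) / ε) : ℝ) : ℂ) * F x := by
    intro p hp ε hε
    have hpI : Set.Icc (p - δ) (p + δ) ⊆ Set.Icc (a - δ) (b + δ) :=
      Set.Icc_subset_Icc (by linarith [hp.1]) (by linarith [hp.2])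
    have hJ := (isLocalDensity_const (Ω := Ω) J).locIntegrable_mulVec hub i
    have hc : Continuous fun x : ℝ => ε⁻¹ * deriv smoothStep ((x - p) / ε) :=
      continuous_const.mul (continuous_deriv_smoothStep.comp (by fun_prop))
    have hz : ∀ x ∉ Set.Icc (p - δ) (p + δ), ε⁻¹ * deriv smoothStep ((x - p) / ε) = 0 := by
      intro x hx
      rw [deriv_smoothStep_eq_zero, mul_zero]
      rw [abs_div, abs_of_pos hε.1, lt_div_iff₀ hε.1, one_mul]
      by_contra! hlt
      have := abs_le.mp hlt
      exact hx ⟨by linarith [hε.2], by linarith [hε.2]⟩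
    obtain ⟨B, hB⟩ := hc.bounded_above_of_compact_support
      (HasCompactSupport.intro isCompact_Icc hz)
    have hk : IsCompactKernel Ω fun x : ℝ => ε⁻¹ * deriv smoothStep ((x - p) / ε) :=
      ⟨hc.measurable, ⟨B, hB⟩, _, isCompact_Icc, hpI.trans hsub, hz⟩
    refine (hJ.integrable_mul hk).congr (Eventually.of_forall fun x => ?_)
    simp only
    by_cases hx : x ∈ Set.Icc (p - δ) (p + δ)
    · rw [hFu x (hsub (hpI hx))]
    · rw [hz x hx]; simp
  have hlim := (((hpeak s hsab).sub (hpeak t htab)).neg).add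
    (hq.tendsto_integral_smoothKernel hΩ hs ht)
  have hlim2 := hw.tendsto_integral_smoothKernel hΩ hs ht
  have heq : ∀ᶠ ε in 𝓝[>] (0 : ℝ),
      ∫ x, (smoothKernel s t ε x : ℂ) * ((weight w).W x *ᵥ f x) i ∂(weight w).S =
      -((∫ x, ((ε⁻¹ * deriv smoothStep ((x - s) / ε) : ℝ) : ℂ) * F x) -
        ∫ x, ((ε⁻¹ * deriv smoothStep ((x - t) / ε) : ℝ) : ℂ) * F x) +
      ∫ x, (smoothKernel s t ε x : ℂ) * ((coeffMeasure q).2 x *ᵥ u x) i ∂(coeffMeasure q).1 := by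
    filter_upwards [Ioo_mem_nhdsGT hδ] with ε hε
    have hz : ∀ x ∉ Set.Icc (a - ε) (b + ε), smoothKernel s t ε x = 0 := fun x hx =>
      smoothKernel_eq_zero hε.1 hsab htab hx
    have hIsub : Set.Icc (a - ε) (b + ε) ⊆ Ω :=
      (Set.Icc_subset_Icc (by linarith [hε.2]) (by linarith [hε.2])).trans hsub
    have hts : tsupport (smoothKernel s t ε) ⊆ Set.Icc (a - ε) (b + ε) :=
      closure_minimal (fun x hx => by by_contra h; exact hx (hz x h)) isClosed_Icc
    -- For `ε < δ` the support stays inside `Ω`, so the smooth kernel is an admissible test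
    -- function.
    let φ : 𝓓(Ω, ℝ) := ⟨smoothKernel s t ε, contDiff_smoothKernel s t ε,
      HasCompactSupport.intro isCompact_Icc hz, hts.trans hIsub⟩
    have h := hsol φ i
    have hφ : (φ : ℝ → ℝ) = smoothKernel s t ε := rfl
    rw [hφ] at h
    rw [← h, ← integral_sub (hpint s hsab ε hε) (hpint t htab ε hε)]
    congr 2
    refine integral_congr_ae (Eventually.of_forall fun x => ?_)
    simp only
    by_cases hx : x ∈ Ω
    · rw [hFu x hx, deriv_smoothKernel]
      push_cast
      ring
    · have hd : deriv (smoothKernel s t ε) x = 0 := by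
        by_contra hd
        exact hx (hIsub (hts (support_deriv_subset hd)))
      rw [hd, ← sub_mul, ← Complex.ofReal_sub, ← deriv_smoothKernel, hd]
      simp
  have huniq := tendsto_nhds_unique (hlim2.congr' heq) hlim
  rw [huniq]
  ring

end IntegralEquation

/-! ### A priori estimates -/

section Estimates

variable {Ω : Opens ℝ} {n : ℕ}

/-- Cauchy–Schwarz against `k eᵢ`, where `‖k eᵢ‖²` is at most the integral of `entryNorm W` over
`K`. The constant depends on `K` alone, not on `k` or `f`. -/
theorem MatrixWeight.exists_norm_integral_le {ω : MatrixWeight n} (hω : IsLocalDensity Ω ω.S ω.W)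
    {K : Set ℝ} (hK : IsCompact K) (hKΩ : K ⊆ Ω) :
    ∃ C, 0 ≤ C ∧ ∀ k : ℝ → ℝ, Measurable k → (∀ x, |k x| ≤ 1) → (∀ x ∉ K, k x = 0) →
      ∀ (f : ω.L2Fun) (i : Fin n), ‖∫ x, (k x : ℂ) * (ω.W x *ᵥ f x) i ∂ω.S‖ ≤ C * ‖f‖ := by
  refine ⟨√(∫ x in K, entryNorm (ω.W x) ∂ω.S), Real.sqrt_nonneg _, fun k hkm hk1 hk0 f i => ?_⟩
  have hk : IsCompactKernel Ω k := ⟨hkm, ⟨1, hk1⟩, K, hK, hKΩ, hk0⟩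
  rw [← inner_single hω hk i f]
  refine (norm_inner_le_norm _ _).trans (mul_le_mul_of_nonneg_right ?_ (norm_nonneg f))
  refine Real.le_sqrt_of_sq_le ?_
  have h1 : ‖single hω hk i‖ ^ 2 =
      ‖∫ x, (k x : ℂ) * (ω.W x *ᵥ (single hω hk i : ℝ → Fin n → ℂ) x) i ∂ω.S‖ := by
    rw [← inner_single hω hk i, inner_self_eq_norm_sq_to_K]
    simp
  rw [h1, ← integral_indicator hK.measurableSet]
  refine norm_integral_le_of_norm_le
    ((integrable_indicator_iff hK.measurableSet).mpr (hω.integrableOn_entryNorm hK hKΩ))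
    (Eventually.of_forall fun x => ?_)
  by_cases hx : x ∈ K
  · rw [Set.indicator_of_mem hx, norm_mul, Complex.norm_real, Real.norm_eq_abs]
    refine (mul_le_of_le_one_left (norm_nonneg _) (hk1 x)).trans ?_
    refine (norm_mulVec_apply_le _ _ i).trans (mul_le_of_le_one_right (entryNorm_nonneg _) ?_)
    change ‖(Pi.single i (k x : ℂ) : Fin n → ℂ)‖ ≤ 1
    rw [Pi.norm_single, Complex.norm_real]
    exact hk1 x
  · rw [hk0 x hx]
    simp [hx]

/-- The punctured intervals decrease to the empty set. The point `p` is removed because an atom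
there does not become small. -/
theorem IsLocalDensity.exists_small_punctured {ν : Measure ℝ}
    {h : ℝ → Matrix (Fin n) (Fin n) ℂ} (hh : IsLocalDensity Ω ν h) {p : ℝ} (hp : p ∈ Ω) {η : ℝ}
    (hη : 0 < η) : ∃ δ > 0, Set.Icc (p - δ) (p + δ) ⊆ Ω ∧
      ∫ x in Set.Icc (p - δ) (p + δ) \ {p}, entryNorm (h x) ∂ν < η := by
  obtain ⟨δ₀, hδ₀, hsub⟩ := Metric.isOpen_iff.mp Ω.isOpen p hp
  have hsub' : ∀ δ, δ < δ₀ → Set.Icc (p - δ) (p + δ) ⊆ Ω := fun δ hδ x hx => hsub (by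
    rw [Metric.mem_ball, Real.dist_eq, abs_lt]
    exact ⟨by linarith [hx.1], by linarith [hx.2]⟩)
  set d : ℕ → ℝ := fun m => δ₀ / 2 * (1 / ((m : ℝ) + 1)) with hd
  have hdpos : ∀ m, 0 < d m := fun m => by positivity
  have hdanti : Antitone d := fun k m hkm =>
    mul_le_mul_of_nonneg_left (one_div_le_one_div_of_le (by positivity)
      (by exact_mod_cast Nat.succ_le_succ hkm)) (by positivity)
  have hdlt : ∀ m, d m < δ₀ := fun m => by
    have h0 : d m ≤ d 0 := hdanti (Nat.zero_le m)
    have : d 0 = δ₀ / 2 := by simp [hd]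
    linarith
  have hdlim : Tendsto d atTop (𝓝 0) := by
    simpa [hd] using (tendsto_one_div_add_atTop_nhds_zero_nat (𝕜 := ℝ)).const_mul (δ₀ / 2)
  have hlim := Antitone.tendsto_setIntegral (μ := ν) (f := fun x => entryNorm (h x))
    (s := fun m => Set.Icc (p - d m) (p + d m) \ {p})
    (fun m => measurableSet_Icc.diff (measurableSet_singleton p))
    (fun k m hkm => Set.sdiff_subset_sdiff_left
      (Set.Icc_subset_Icc (by linarith [hdanti hkm]) (by linarith [hdanti hkm])))
    ((hh.integrableOn_entryNorm isCompact_Icc (hsub' _ (hdlt 0))).mono_set Set.sdiff_subset)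
  have hempty : ⋂ m, Set.Icc (p - d m) (p + d m) \ {p} = ∅ := by
    refine Set.eq_empty_of_forall_notMem fun x hx => ?_
    rw [Set.mem_iInter] at hx
    have hne : x ≠ p := (hx 0).2
    have hpos : 0 < |x - p| := abs_pos.mpr (sub_ne_zero.mpr hne)
    obtain ⟨m, hm⟩ := (hdlim.eventually_lt_const hpos).exists
    have := (hx m).1
    exact absurd (abs_le.mpr ⟨by linarith [this.1], by linarith [this.2]⟩) (not_le.mpr hm)
  rw [hempty, Measure.restrict_empty, integral_zero_measure] at hlim
  obtain ⟨m, hm⟩ := (hlim.eventually_lt_const hη).exists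
  exact ⟨d m, hdpos m, hsub' _ (hdlt m), hm⟩

/-- Balanced solutions of `J u' + q u = w f` with `f ∈ 𝓛²(w)`. -/
structure IsL2Solution (J : Matrix (Fin n) (Fin n) ℂ) (q w : DistMatrix Ω n)
    (u : ℝ → Fin n → ℂ) (f : (weight w).L2Fun) : Prop where
  bv : IsBalancedBV Ω u
  eq : IsSolution J q w u f

variable {J : Matrix (Fin n) (Fin n) ℂ} {q w : DistMatrix Ω n}

/-- Across the point `p`, a solution changes by the jump at `p` up to a small error. -/
theorem IsL2Solution.norm_sub_le (hΩ : (Ω : Set ℝ).OrdConnected) {u : ℝ → Fin n → ℂ}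
    {f : (weight w).L2Fun} (hu : IsL2Solution J q w u f) {p δ C M : ℝ} (hδ : 0 < δ)
    (hsub : Set.Icc (p - δ) (p + δ) ⊆ Ω)
    (hC : ∀ k : ℝ → ℝ, Measurable k → (∀ x, |k x| ≤ 1) →
      (∀ x ∉ Set.Icc (p - δ) (p + δ), k x = 0) → ∀ i : Fin n,
      ‖∫ x, (k x : ℂ) * ((weight w).W x *ᵥ f x) i ∂(weight w).S‖ ≤ C * ‖f‖)
    (hC0 : 0 ≤ C) (hM0 : 0 ≤ M)
    (hM : ∀ x ∈ Set.Icc (p - δ) (p + δ), ‖u x‖ ≤ M) {x : ℝ}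
    (hx : x ∈ Set.Icc (p - δ) (p + δ)) :
    ‖J *ᵥ u x - (J - (jumpKernel p x p : ℂ) • jump q p) *ᵥ u p‖ ≤
      (∫ x in Set.Icc (p - δ) (p + δ) \ {p},
        entryNorm ((coeffMeasure q).2 x) ∂(coeffMeasure q).1) * M + C * ‖f‖ := by
  have hpI : p ∈ Set.Icc (p - δ) (p + δ) := ⟨by linarith, by linarith⟩
  have hq := isLocalDensity_coeffMeasure q
  have hk := isCompactKernel_jumpKernel hΩ (hsub hpI) (hsub hx)
  set ν := (coeffMeasure q).1 with hν
  set h := (coeffMeasure q).2 with hh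
  have hint0 : 0 ≤ ∫ x in Set.Icc (p - δ) (p + δ) \ {p}, entryNorm (h x) ∂ν :=
    integral_nonneg fun _ => entryNorm_nonneg _
  refine (pi_norm_le_iff_of_nonneg (by positivity)).mpr fun i => ?_
  have hI := (hq.locIntegrable_mulVec hu.bv.isLocBounded i).integrable_mul hk
  have heq := integral_equation hΩ f hu.bv hu.eq (hsub hpI) (hsub hx) i
  have hsplit := integral_add_compl (measurableSet_singleton p) hI
  -- The atom at `p` contributes the weight `jumpKernel p x p` times `jump q p`. Moved to the other
  -- side, it modifies the matrix acting on `u p` and leaves only the punctured interval to be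
  -- estimated.
  have hsing : ∫ y in {p}, (jumpKernel p x y : ℂ) * (h y *ᵥ u y) i ∂ν =
      (jumpKernel p x p : ℂ) * (jump q p *ᵥ u p) i := by
    rw [integral_singleton, jump, smul_mulVec, Pi.smul_apply, smul_eq_mul, Complex.real_smul]
    ring
  have hval : (J *ᵥ u x - (J - (jumpKernel p x p : ℂ) • jump q p) *ᵥ u p) i =
      -(∫ y in {p}ᶜ, (jumpKernel p x y : ℂ) * (h y *ᵥ u y) i ∂ν) +
        ∫ x_1, (jumpKernel p x x_1 : ℂ) * ((weight w).W x_1 *ᵥ f x_1) i ∂(weight w).S := by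
    rw [Pi.sub_apply, sub_mulVec, smul_mulVec, Pi.sub_apply, Pi.smul_apply, smul_eq_mul, ← hsing,
      sub_sub_eq_add_sub, add_sub_right_comm, heq, ← hsplit]
    ring
  rw [hval]
  refine (norm_add_le _ _).trans (add_le_add ?_ ?_)
  · rw [norm_neg, ← integral_mul_const, ← integral_indicator (by measurability),
      ← integral_indicator (by measurability)]
    refine norm_integral_le_of_norm_le ?_ (Eventually.of_forall fun y => ?_)
    · exact (integrable_indicator_iff (by measurability)).mpr
        (((hq.integrableOn_entryNorm isCompact_Icc hsub).mono_set Set.sdiff_subset).mul_const M)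
    · by_cases hyp : y = p
      · simp [hyp]
      by_cases hy : y ∈ Set.Icc (p - δ) (p + δ)
      · rw [Set.indicator_of_mem (by simpa using hyp),
          Set.indicator_of_mem (show y ∈ Set.Icc (p - δ) (p + δ) \ {p} from ⟨hy, hyp⟩), norm_mul,
          Complex.norm_real, Real.norm_eq_abs]
        refine (mul_le_of_le_one_left (norm_nonneg _) (abs_jumpKernel_le _ _ _)).trans ?_
        exact (norm_mulVec_apply_le _ _ i).trans
          (mul_le_mul_of_nonneg_left (hM y hy) (entryNorm_nonneg _))
      · rw [Set.indicator_of_mem (by simpa using hyp), jumpKernel_eq_zero hpI hx hy,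
          Set.indicator_of_notMem fun hy' => hy hy'.1]
        simp
  · exact hC _ (measurable_jumpKernel p x) (abs_jumpKernel_le p x)
      (fun y hy => jumpKernel_eq_zero hpI hx hy) i

theorem norm_le_of_isUnit {A : Matrix (Fin n) (Fin n) ℂ} (hA : IsUnit A) (u : Fin n → ℂ) :
    ‖u‖ ≤ entryNorm A⁻¹ * ‖A *ᵥ u‖ := by
  have h : A⁻¹ *ᵥ (A *ᵥ u) = u := by
    rw [mulVec_mulVec, nonsing_inv_mul _ ((Matrix.isUnit_iff_isUnit_det _).mp hA), one_mulVec]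
  calc ‖u‖ = ‖A⁻¹ *ᵥ (A *ᵥ u)‖ := by rw [h]
    _ ≤ _ := norm_mulVec_le _ _

/-- On a short interval around `p` the supremum of `‖u‖` reappears with a small factor and can be
absorbed. Invertibility of `J` bounds `u x` by `u p`, and that of `J ± ½ Δ_q(p)` bounds `u p` by `u
x`. The neighbourhood does not depend on `u` or `f`. -/
theorem exists_local_bound (hΩ : (Ω : Set ℝ).OrdConnected) (hJ : IsUnit J)
    (hjump : ∀ x ∈ Ω, IsUnit ((2 : ℂ) • J + jump q x) ∧ IsUnit ((2 : ℂ) • J - jump q x))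
    {p : ℝ} (hp : p ∈ Ω) :
    ∃ C, 0 ≤ C ∧ ∀ᶠ x in 𝓝 p, ∀ u f, IsL2Solution J q w u f →
      ‖u x‖ ≤ C * (‖u p‖ + ‖f‖) ∧ ‖u p‖ ≤ C * (‖u x‖ + ‖f‖) := by
  have hq := isLocalDensity_coeffMeasure q
  have hw := isLocalDensity_weight w
  have h2 : IsUnit (2⁻¹ : ℂ) := by norm_num
  have hplus : IsUnit (J + (2⁻¹ : ℂ) • jump q p) := by
    have h := (hjump p hp).1.smul h2.unit
    have e : h2.unit • ((2 : ℂ) • J + jump q p) = J + (2⁻¹ : ℂ) • jump q p := by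
      rw [Units.smul_def, IsUnit.unit_spec, smul_add, smul_smul]
      norm_num
    rwa [e] at h
  have hminus : IsUnit (J - (2⁻¹ : ℂ) • jump q p) := by
    have h := (hjump p hp).2.smul h2.unit
    have e : h2.unit • ((2 : ℂ) • J - jump q p) = J - (2⁻¹ : ℂ) • jump q p := by
      rw [Units.smul_def, IsUnit.unit_spec, smul_sub, smul_smul]
      norm_num
    rwa [e] at h
  obtain ⟨α, hα⟩ : ∃ r, r = entryNorm J⁻¹ := ⟨_, rfl⟩
  obtain ⟨A, hA⟩ : ∃ r, r = entryNorm (J + (2⁻¹ : ℂ) • jump q p) + entryNorm (J - (2⁻¹ : ℂ) • jump q p) := ⟨_, rfl⟩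
  obtain ⟨b, hb⟩ : ∃ r, r = entryNorm (J + (2⁻¹ : ℂ) • jump q p)⁻¹ + entryNorm (J - (2⁻¹ : ℂ) • jump q p)⁻¹ := ⟨_, rfl⟩
  have hα0 : 0 ≤ α := hα ▸ entryNorm_nonneg _
  have hA0 : 0 ≤ A := hA ▸ add_nonneg (entryNorm_nonneg _) (entryNorm_nonneg _)
  have hb0 : 0 ≤ b := hb ▸ add_nonneg (entryNorm_nonneg _) (entryNorm_nonneg _)
  -- The weight `jumpKernel p x p` is `-1/2` for `x < p` and `1/2` for `x > p`. The sums `A` and `b`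
  -- bound both cases at once.
  have hside : ∀ x, x ≠ p → ∃ B : Matrix (Fin n) (Fin n) ℂ,
      B = J - (jumpKernel p x p : ℂ) • jump q p ∧ IsUnit B ∧ entryNorm B ≤ A ∧
      entryNorm B⁻¹ ≤ b := by
    intro x hx
    rcases lt_or_gt_of_ne hx with hlt | hlt
    · refine ⟨J + (2⁻¹ : ℂ) • jump q p, ?_, hplus, ?_, ?_⟩
      · rw [jumpKernel, sub_self, heaviside_zero, heaviside_of_pos (by linarith), sub_eq_add_neg,
          ← neg_smul]
        norm_num
      · linarith [entryNorm_nonneg (J - (2⁻¹ : ℂ) • jump q p)]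
      · linarith [entryNorm_nonneg (J - (2⁻¹ : ℂ) • jump q p)⁻¹]
    · refine ⟨J - (2⁻¹ : ℂ) • jump q p, ?_, hminus, ?_, ?_⟩
      · rw [jumpKernel, sub_self, heaviside_zero, heaviside_of_neg (by linarith)]
        norm_num
      · linarith [entryNorm_nonneg (J + (2⁻¹ : ℂ) • jump q p)]
      · linarith [entryNorm_nonneg (J + (2⁻¹ : ℂ) • jump q p)⁻¹]
  obtain ⟨D, hD⟩ : ∃ r, r = 2 * (1 + α * A) := ⟨_, rfl⟩
  have hD0 : 0 ≤ D := by rw [hD]; positivity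
  -- This `η` makes the punctured mass `m` satisfy both `α m ≤ 1/2` and `b m D ≤ 1/2`, one for each
  -- absorption below.
  obtain ⟨δ, hδ, hsub, hm⟩ := hq.exists_small_punctured hp
    (η := 1 / (2 * (1 + α + b * D))) (by positivity)
  obtain ⟨C, hC0, hC⟩ := MatrixWeight.exists_norm_integral_le hw isCompact_Icc hsub
  obtain ⟨m, hmdef⟩ : ∃ r, r = ∫ x in Set.Icc (p - δ) (p + δ) \ {p},
    entryNorm ((coeffMeasure q).2 x) ∂(coeffMeasure q).1 := ⟨_, rfl⟩
  rw [← hmdef] at hm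
  have hm0 : 0 ≤ m := hmdef ▸ integral_nonneg fun _ => entryNorm_nonneg _
  have hm1 : m * (1 + α + b * D) ≤ 1 / 2 := by
    have hpos : 0 < 1 + α + b * D := by positivity
    rw [lt_div_iff₀ (by positivity)] at hm
    linarith
  have hmα : α * m ≤ 1 / 2 := by
    have : 0 ≤ m * (1 + b * D) := by positivity
    linarith
  have hmb : b * m * D ≤ 1 / 2 := by
    have : 0 ≤ m * (1 + α) := by positivity
    linarith
  have hpI : p ∈ Set.Icc (p - δ) (p + δ) := ⟨by linarith, by linarith⟩
  have hJ0 := entryNorm_nonneg J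
  obtain ⟨E, hE⟩ : ∃ r, r = 2 * (α * C) := ⟨_, rfl⟩
  have hE0 : 0 ≤ E := by rw [hE]; positivity
  refine ⟨max (D + E) (2 * (b * (entryNorm J + C + m * E)) + 1), by positivity, ?_⟩
  filter_upwards [Icc_mem_nhds (show p - δ < p by linarith) (show p < p + δ by linarith)]
    with x hx u f hu
  obtain ⟨M₀, hM₀, hM₀'⟩ := hu.bv.isLocBounded.bounded _ isCompact_Icc hsub
  have hne : ((fun y => ‖u y‖) '' Set.Icc (p - δ) (p + δ)).Nonempty := ⟨_, p, hpI, rfl⟩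
  have hbdd : BddAbove ((fun y => ‖u y‖) '' Set.Icc (p - δ) (p + δ)) :=
    ⟨M₀, by rintro _ ⟨y, hy, rfl⟩; exact hM₀' y hy⟩
  obtain ⟨M, hM⟩ : ∃ r, r = sSup ((fun y => ‖u y‖) '' Set.Icc (p - δ) (p + δ)) := ⟨_, rfl⟩
  have hMle : ∀ y ∈ Set.Icc (p - δ) (p + δ), ‖u y‖ ≤ M := fun y hy =>
    hM ▸ le_csSup hbdd ⟨y, hy, rfl⟩
  have hM0 : 0 ≤ M := (norm_nonneg _).trans (hMle p hpI)
  have key := fun y (hy : y ∈ Set.Icc (p - δ) (p + δ)) =>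
    hu.norm_sub_le hΩ hδ hsub (fun k h1 h2 h3 i => hC k h1 h2 h3 f i) hC0 hM0 hMle hy
  rw [← hmdef] at key
  have hf0 := norm_nonneg f
  have hup0 := norm_nonneg (u p)
  -- The finite supremum `M` occurs on the right with factor `α m ≤ 1/2`. Absorbing it explains the
  -- factor `2` in `D` and `E`, and the summand `1` in `D` covers `y = p`.
  have hMbound : M ≤ D * ‖u p‖ + E * ‖f‖ := by
    have : M ≤ (1 + α * A) * ‖u p‖ + α * C * ‖f‖ + M / 2 := by
      refine hM.trans_le (csSup_le hne ?_)
      rintro _ ⟨y, hy, rfl⟩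
      have hαA : 0 ≤ α * A * ‖u p‖ := by positivity
      have hαC : 0 ≤ α * C * ‖f‖ := by positivity
      by_cases hyp : y = p
      · subst hyp
        simp only
        nlinarith
      · obtain ⟨B, hB, -, hBA, -⟩ := hside y hyp
        have k1 := key y hy
        rw [← hB] at k1
        have k2 : ‖J *ᵥ u y‖ ≤ A * ‖u p‖ + (m * M + C * ‖f‖) := by
          have t1 := norm_sub_norm_le (J *ᵥ u y) (B *ᵥ u p)
          have t2 := (norm_mulVec_le B (u p)).trans (mul_le_mul_of_nonneg_right hBA hup0)
          linarith
        have k3 := (hα ▸ norm_le_of_isUnit hJ (u y)).trans (mul_le_mul_of_nonneg_left k2 hα0)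
        have k4 : α * m * M ≤ 1 / 2 * M := mul_le_mul_of_nonneg_right hmα hM0
        simp only
        nlinarith
    rw [hD, hE]
    linarith
  refine ⟨?_, ?_⟩
  · have h1 : D * ‖u p‖ + E * ‖f‖ ≤ (D + E) * (‖u p‖ + ‖f‖) := by nlinarith
    exact ((hMle x hx).trans hMbound).trans (h1.trans
      (mul_le_mul_of_nonneg_right (le_max_left _ _) (by positivity)))
  · have hux0 := norm_nonneg (u x)
    have h2 : ‖u p‖ ≤ (2 * (b * (entryNorm J + C + m * E)) + 1) * (‖u x‖ + ‖f‖) := by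
      by_cases hxp : x = p
      · subst hxp
        have : 0 ≤ 2 * (b * (entryNorm J + C + m * E)) * (‖u x‖ + ‖f‖) := by positivity
        linarith
      · obtain ⟨B, hB, hBu, -, hBb⟩ := hside x hxp
        have k1 := key x hx
        rw [← hB, norm_sub_rev] at k1
        have k2 : ‖B *ᵥ u p‖ ≤ entryNorm J * ‖u x‖ + (m * M + C * ‖f‖) := by
          have t1 := norm_sub_norm_le (B *ᵥ u p) (J *ᵥ u x)
          have t2 := norm_mulVec_le J (u x)
          linarith
        have k3 : ‖u p‖ ≤ b * (entryNorm J * ‖u x‖ + (m * M + C * ‖f‖)) :=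
          (norm_le_of_isUnit hBu (u p)).trans
            (mul_le_mul hBb k2 (norm_nonneg _) hb0)
        have k4 : b * m * M ≤ b * m * (D * ‖u p‖ + E * ‖f‖) :=
          mul_le_mul_of_nonneg_left hMbound (by positivity)
        -- Inserting the bound for `M` brings `u p` back on the right with factor at most `1/2`,
        -- which is absorbed in turn.
        have k5 : b * m * D * ‖u p‖ ≤ 1 / 2 * ‖u p‖ := mul_le_mul_of_nonneg_right hmb hup0
        have k6 : ‖u p‖ ≤ 2 * (b * (entryNorm J * ‖u x‖ + C * ‖f‖ + m * E * ‖f‖)) := by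
          linarith
        refine k6.trans ?_
        have z1 : 0 ≤ b * entryNorm J * ‖f‖ := by positivity
        have z2 : 0 ≤ b * C * ‖u x‖ := by positivity
        have z3 : 0 ≤ b * (m * E) * ‖u x‖ := by positivity
        linarith
    exact h2.trans (mul_le_mul_of_nonneg_right (le_max_right _ _) (by positivity))

/-- Controlling `u x` by `u x₀` and `f` is a transitive relation between points, and it holds
locally in both directions. Connectedness of `Ω` makes it hold for all pairs. -/
theorem exists_bound (hΩ : (Ω : Set ℝ).OrdConnected) (hJ : IsUnit J)
    (hjump : ∀ x ∈ Ω, IsUnit ((2 : ℂ) • J + jump q x) ∧ IsUnit ((2 : ℂ) • J - jump q x))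
    {x₀ x : ℝ} (hx₀ : x₀ ∈ Ω) (hx : x ∈ Ω) :
    ∃ C, 0 ≤ C ∧ ∀ u f, IsL2Solution J q w u f → ‖u x‖ ≤ C * (‖u x₀‖ + ‖f‖) := by
  refine hΩ.isPreconnected.induction₂' (fun x₀ x => ∃ C, 0 ≤ C ∧ ∀ u f,
    IsL2Solution J q w u f → ‖u x‖ ≤ C * (‖u x₀‖ + ‖f‖)) ?_ ?_ hx₀ hx
  · intro p hp
    obtain ⟨C, hC0, hC⟩ := exists_local_bound (w := w) hΩ hJ hjump hp
    filter_upwards [hC.filter_mono nhdsWithin_le_nhds] with y hy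
    exact ⟨⟨C, hC0, fun u f hu => (hy u f hu).1⟩, ⟨C, hC0, fun u f hu => (hy u f hu).2⟩⟩
  · rintro x y z - - - ⟨C, hC0, hC⟩ ⟨C', hC'0, hC'⟩
    refine ⟨C' * (C + 1), by positivity, fun u f hu => ?_⟩
    have h1 := hC u f hu
    have h2 := hC' u f hu
    have h3 : ‖u y‖ + ‖f‖ ≤ (C + 1) * (‖u x‖ + ‖f‖) := by
      have := norm_nonneg (u x)
      linarith
    calc ‖u z‖ ≤ C' * (‖u y‖ + ‖f‖) := h2
      _ ≤ C' * ((C + 1) * (‖u x‖ + ‖f‖)) := mul_le_mul_of_nonneg_left h3 hC'0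
      _ = _ := by ring

/-- On compact sets, solutions of `J u' + q u = w f` are bounded by their initial value and the
norm of `f`. -/
theorem exists_bound_on_compact (hΩ : (Ω : Set ℝ).OrdConnected) (hJ : IsUnit J)
    (hjump : ∀ x ∈ Ω, IsUnit ((2 : ℂ) • J + jump q x) ∧ IsUnit ((2 : ℂ) • J - jump q x))
    {x₀ : ℝ} (hx₀ : x₀ ∈ Ω) {K : Set ℝ} (hK : IsCompact K) (hKΩ : K ⊆ Ω) :
    ∃ C, 0 ≤ C ∧ ∀ u f, IsL2Solution J q w u f → ∀ x ∈ K, ‖u x‖ ≤ C * (‖u x₀‖ + ‖f‖) := by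
  refine hK.induction_on (p := fun K => ∃ C, 0 ≤ C ∧ ∀ u f, IsL2Solution J q w u f → ∀ x ∈ K,
    ‖u x‖ ≤ C * (‖u x₀‖ + ‖f‖)) ⟨0, le_rfl, by simp⟩ ?_ ?_ ?_
  · rintro s t hst ⟨C, hC0, hC⟩
    exact ⟨C, hC0, fun u f hu x hx => hC u f hu x (hst hx)⟩
  · rintro s t ⟨C, hC0, hC⟩ ⟨C', hC'0, hC'⟩
    refine ⟨max C C', le_max_of_le_left hC0, fun u f hu x hx => ?_⟩
    rcases hx with hx | hx
    · exact (hC u f hu x hx).trans (mul_le_mul_of_nonneg_right (le_max_left _ _) (by positivity))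
    · exact (hC' u f hu x hx).trans (mul_le_mul_of_nonneg_right (le_max_right _ _) (by positivity))
  -- Near `p` the local bound compares with `u p`, and the global pointwise bound compares `u p`
  -- with `u x₀`.
  · intro p hp
    obtain ⟨C, hC0, hC⟩ := exists_local_bound (w := w) hΩ hJ hjump (hKΩ hp)
    obtain ⟨C', hC'0, hC'⟩ := exists_bound (w := w) hΩ hJ hjump hx₀ (hKΩ hp)
    refine ⟨_, mem_nhdsWithin_of_mem_nhds hC, C * (C' + 1), by positivity,
      fun u f hu x hx => ?_⟩
    have h1 := (hx u f hu).1
    have h2 := hC' u f hu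
    have h3 : ‖u p‖ + ‖f‖ ≤ (C' + 1) * (‖u x₀‖ + ‖f‖) := by
      have := norm_nonneg (u x₀)
      linarith
    calc ‖u x‖ ≤ C * (‖u p‖ + ‖f‖) := h1
      _ ≤ C * ((C' + 1) * (‖u x₀‖ + ‖f‖)) := mul_le_mul_of_nonneg_left h3 hC0
      _ = _ := by ring

end Estimates

/-! ### Linear combinations of solutions -/

section Linear

variable {Ω : Opens ℝ} {n : ℕ}

theorem _root_.LocallyBoundedVariationOn.add_fun {u v : ℝ → Fin n → ℂ} {s : Set ℝ}
    (hu : LocallyBoundedVariationOn u s) (hv : LocallyBoundedVariationOn v s) :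
    LocallyBoundedVariationOn (u + v) s := by
  intro a b ha hb
  refine ne_top_of_le_ne_top (ENNReal.add_ne_top.mpr ⟨hu a b ha hb, hv a b ha hb⟩) ?_
  refine iSup_le fun p => ?_
  refine le_trans ?_ (add_le_add (eVariationOn.sum_le (n := p.1) p.2.2.1 p.2.2.2)
    (eVariationOn.sum_le (n := p.1) p.2.2.1 p.2.2.2))
  rw [← Finset.sum_add_distrib]
  exact Finset.sum_le_sum fun _ _ => edist_add_add_le _ _ _ _

theorem _root_.LocallyBoundedVariationOn.const_smul_fun {u : ℝ → Fin n → ℂ} {s : Set ℝ}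
    (hu : LocallyBoundedVariationOn u s) (c : ℂ) :
    LocallyBoundedVariationOn (c • u) s :=
  (lipschitzWith_smul (β := Fin n → ℂ) c).comp_locallyBoundedVariationOn hu

theorem IsBalancedBV.add {u v : ℝ → Fin n → ℂ} (hu : IsBalancedBV Ω u) (hv : IsBalancedBV Ω v) :
    IsBalancedBV Ω (u + v) := by
  refine ⟨hu.1.add_fun hv.1, fun x hx => ?_⟩
  obtain ⟨l, r, hl, hr, he⟩ := hu.2 x hx
  obtain ⟨l', r', hl', hr', he'⟩ := hv.2 x hx
  refine ⟨l + l', r + r', hl.add hl', hr.add hr', ?_⟩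
  rw [Pi.add_apply, he, he', ← smul_add]
  congr 1
  abel

theorem IsBalancedBV.smul {u : ℝ → Fin n → ℂ} (hu : IsBalancedBV Ω u) (c : ℂ) :
    IsBalancedBV Ω (c • u) := by
  refine ⟨hu.1.const_smul_fun c, fun x hx => ?_⟩
  obtain ⟨l, r, hl, hr, he⟩ := hu.2 x hx
  refine ⟨c • l, c • r, hl.const_smul c, hr.const_smul c, ?_⟩
  rw [Pi.smul_apply, he, ← smul_add, smul_comm]

variable {J : Matrix (Fin n) (Fin n) ℂ} {q w : DistMatrix Ω n}

theorem IsL2Solution.add {u v : ℝ → Fin n → ℂ} {f g : (weight w).L2Fun}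
    (hu : IsL2Solution J q w u f) (hv : IsL2Solution J q w v g) :
    IsL2Solution J q w (u + v) (f + g) := by
  refine ⟨hu.bv.add hv.bv, fun φ i => ?_⟩
  have hφ := isCompactKernel_testFunction φ
  have hφ' := isCompactKernel_deriv φ
  have hJ := isLocalDensity_const (Ω := Ω) J
  have hq := isLocalDensity_coeffMeasure q
  have hw := isLocalDensity_weight w
  have i1 := (hJ.locIntegrable_mulVec hu.bv.isLocBounded i).integrable_mul hφ'
  have i2 := (hJ.locIntegrable_mulVec hv.bv.isLocBounded i).integrable_mul hφ'
  have i3 := (hq.locIntegrable_mulVec hu.bv.isLocBounded i).integrable_mul hφ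
  have i4 := (hq.locIntegrable_mulVec hv.bv.isLocBounded i).integrable_mul hφ
  have i5 := (MatrixWeight.locIntegrable_mulVec hw f i).integrable_mul hφ
  have i6 := (MatrixWeight.locIntegrable_mulVec hw g i).integrable_mul hφ
  have h1 := hu.eq φ i
  have h2 := hv.eq φ i
  have hfg : ∀ x, ((f + g : (weight w).L2Fun) : ℝ → Fin n → ℂ) x = f x + g x := fun _ => rfl
  simp only [Pi.add_apply, mulVec_add, mul_add, hfg]
  rw [integral_add i1 i2, integral_add i3 i4, integral_add i5 i6, ← h1, ← h2]
  ring

theorem IsL2Solution.smul {u : ℝ → Fin n → ℂ} {f : (weight w).L2Fun}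
    (hu : IsL2Solution J q w u f) (c : ℂ) : IsL2Solution J q w (c • u) (c • f) := by
  refine ⟨hu.bv.smul c, fun φ i => ?_⟩
  have h1 := hu.eq φ i
  have hf : ∀ x, ((c • f : (weight w).L2Fun) : ℝ → Fin n → ℂ) x = c • f x := fun _ => rfl
  simp only [Pi.smul_apply, mulVec_smul, hf, smul_eq_mul, mul_left_comm _ c]
  rw [integral_const_mul, integral_const_mul, integral_const_mul, ← h1]
  ring

theorem IsL2Solution.sub {u v : ℝ → Fin n → ℂ} {f g : (weight w).L2Fun}
    (hu : IsL2Solution J q w u f) (hv : IsL2Solution J q w v g) :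
    IsL2Solution J q w (u - v) (f - g) := by
  have h := hu.add (hv.smul (-1))
  rwa [neg_one_smul, neg_one_smul, ← sub_eq_add_neg, ← sub_eq_add_neg] at h

/-- The equation sees `f` only through `W f`, which depends on the class alone up to null sets. -/
theorem IsL2Solution.congr_right {u : ℝ → Fin n → ℂ} {f g : (weight w).L2Fun}
    (hu : IsL2Solution J q w u f) (hfg : (weight w).toL2 f = (weight w).toL2 g) :
    IsL2Solution J q w u g := by
  have h0 : (weight w).toL2 (f - g) = 0 := by rw [MatrixWeight.toL2_sub, hfg, sub_self]
  refine ⟨hu.bv, fun φ i => (hu.eq φ i).trans (integral_congr_ae ?_)⟩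
  filter_upwards [(MatrixWeight.toL2_eq_zero_iff _).mp h0] with x hx
  have hx' : (weight w).W x *ᵥ (f x - g x) = 0 := hx
  rw [mulVec_sub, sub_eq_zero] at hx'
  rw [hx']

/-- `W u` is locally integrable, so if it vanishes against test functions it vanishes almost
everywhere on `Ω`. The complement of `Ω` is a null set of the weight. -/
theorem mem_zeroSolutions_iff {u : ℝ → Fin n → ℂ} : u ∈ zeroSolutions J q w ↔
    IsL2Solution J q w u 0 ∧ ∀ᵐ x ∂(weight w).S, (weight w).W x *ᵥ u x = 0 := by
  refine ⟨fun ⟨h1, h2, h3⟩ => ⟨⟨h1, h2⟩, ?_⟩, fun ⟨h1, h2⟩ => ⟨h1.bv, h1.eq, fun φ i => ?_⟩⟩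
  · have hw := isLocalDensity_weight w
    have hi : ∀ i, ∀ᵐ x ∂(weight w).S, x ∈ (Ω : Set ℝ) → ((weight w).W x *ᵥ u x) i = 0 := by
      intro i
      have hint := hw.locIntegrable_mulVec h1.isLocBounded i
      refine Ω.isOpen.ae_eq_zero_of_integral_contDiff_smul_eq_zero ?_ fun g hg hgc hgs => ?_
      · exact (locallyIntegrableOn_iff Ω.isOpen.isLocallyClosed).mpr
          fun K hKΩ hK => hint K hK hKΩ
      · simpa using h3 ⟨g, hg, hgc, hgs⟩ i
    have hΩ : ∀ᵐ x ∂(weight w).S, x ∈ (Ω : Set ℝ) := weight_null_compl w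
    filter_upwards [ae_all_iff.mpr hi, hΩ] with x hx hxΩ
    exact funext fun i => hx i hxΩ
  · refine integral_eq_zero_of_ae ?_
    filter_upwards [h2] with x hx
    simp [hx]

theorem zeroSolutions_add {u v : ℝ → Fin n → ℂ} (hu : u ∈ zeroSolutions J q w)
    (hv : v ∈ zeroSolutions J q w) : u + v ∈ zeroSolutions J q w := by
  rw [mem_zeroSolutions_iff] at *
  refine ⟨by simpa using hu.1.add hv.1, ?_⟩
  filter_upwards [hu.2, hv.2] with x h1 h2
  rw [Pi.add_apply, mulVec_add, h1, h2, add_zero]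

theorem zeroSolutions_smul {u : ℝ → Fin n → ℂ} (hu : u ∈ zeroSolutions J q w) (c : ℂ) :
    c • u ∈ zeroSolutions J q w := by
  rw [mem_zeroSolutions_iff] at *
  refine ⟨by simpa using hu.1.smul c, ?_⟩
  filter_upwards [hu.2] with x h1
  rw [Pi.smul_apply, mulVec_smul, h1, smul_zero]

theorem zero_mem_zeroSolutions : (0 : ℝ → Fin n → ℂ) ∈ zeroSolutions J q w := by
  refine ⟨⟨fun a b _ _ => ?_, fun x _ => ⟨0, 0, tendsto_const_nhds, tendsto_const_nhds, by simp⟩⟩,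
    fun φ i => by simp, fun φ i => by simp⟩
  rw [BoundedVariationOn, eVariationOn.constant_on]
  · simp
  · rintro _ ⟨x, -, rfl⟩ _ ⟨y, -, rfl⟩
    rfl

/-- Elements of `𝓛₀` can therefore be subtracted from a representative without changing its class.
-/
theorem exists_L2Fun_of_mem_zeroSolutions {u : ℝ → Fin n → ℂ} (hu : u ∈ zeroSolutions J q w) :
    ∃ v : (weight w).L2Fun, (v : ℝ → Fin n → ℂ) = u ∧ (weight w).toL2 v = 0 := by
  obtain ⟨h1, h2⟩ := mem_zeroSolutions_iff.mp hu
  have hmem : (weight w).MemL2 u := by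
    refine ⟨h1.bv.isLocBounded.measurable.aestronglyMeasurable.congr ?_, ?_⟩
    · have hΩ : ∀ᵐ x ∂(weight w).S, x ∈ (Ω : Set ℝ) := weight_null_compl w
      filter_upwards [hΩ] with x hx
      rw [Set.indicator_of_mem hx]
    · refine (integrable_zero _ _ _).congr ?_
      filter_upwards [h2] with x hx
      simp [MatrixWeight.form, hx]
  refine ⟨(⟨u, hmem⟩ : (weight w).l2Submodule), rfl, ?_⟩
  exact (MatrixWeight.toL2_eq_zero_iff _).mpr h2

theorem isEvaluation_iff {x₀ : ℝ} {p : (weight w).L2 × (weight w).L2} {v : (weight w).L2Fun} :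
    IsEvaluation J q w x₀ p v ↔ (weight w).toL2 v = p.1 ∧
      (∃ f : (weight w).L2Fun, (weight w).toL2 f = p.2 ∧ IsL2Solution J q w v f) ∧
      ∀ y ∈ zeroSolutions J q w, star (y x₀) ⬝ᵥ v x₀ = 0 :=
  ⟨fun ⟨h1, h2, ⟨f, h3, h4⟩, h5⟩ => ⟨h1, ⟨f, h3, h2, h4⟩, h5⟩,
    fun ⟨h1, ⟨f, h3, h2, h4⟩, h5⟩ => ⟨h1, h2, ⟨f, h3, h4⟩, h5⟩⟩

theorem IsEvaluation.add {x₀ : ℝ} {p p' : (weight w).L2 × (weight w).L2}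
    {v v' : (weight w).L2Fun} (hv : IsEvaluation J q w x₀ p v)
    (hv' : IsEvaluation J q w x₀ p' v') : IsEvaluation J q w x₀ (p + p') (v + v') := by
  rw [isEvaluation_iff] at *
  obtain ⟨h1, ⟨f, hf, hs⟩, h2⟩ := hv
  obtain ⟨h1', ⟨f', hf', hs'⟩, h2'⟩ := hv'
  refine ⟨by rw [MatrixWeight.toL2_add, h1, h1', Prod.fst_add],
    ⟨f + f', by rw [MatrixWeight.toL2_add, hf, hf', Prod.snd_add], hs.add hs'⟩, fun y hy => ?_⟩
  change star (y x₀) ⬝ᵥ (v x₀ + v' x₀) = 0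
  rw [dotProduct_add, h2 y hy, h2' y hy, add_zero]

theorem IsEvaluation.smul {x₀ : ℝ} {p : (weight w).L2 × (weight w).L2}
    {v : (weight w).L2Fun} (hv : IsEvaluation J q w x₀ p v) (c : ℂ) :
    IsEvaluation J q w x₀ (c • p) (c • v) := by
  rw [isEvaluation_iff] at *
  obtain ⟨h1, ⟨f, hf, hs⟩, h2⟩ := hv
  refine ⟨by rw [MatrixWeight.toL2_smul, h1, Prod.smul_fst],
    ⟨c • f, by rw [MatrixWeight.toL2_smul, hf, Prod.smul_snd], hs.smul c⟩, fun y hy => ?_⟩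
  change star (y x₀) ⬝ᵥ (c • v x₀) = 0
  rw [dotProduct_smul, h2 y hy, smul_zero]

theorem IsEvaluation.sub {x₀ : ℝ} {p p' : (weight w).L2 × (weight w).L2}
    {v v' : (weight w).L2Fun} (hv : IsEvaluation J q w x₀ p v)
    (hv' : IsEvaluation J q w x₀ p' v') : IsEvaluation J q w x₀ (p - p') (v - v') := by
  have h := hv.add (hv'.smul (-1))
  rwa [neg_one_smul, neg_one_smul, ← sub_eq_add_neg, ← sub_eq_add_neg] at h

/-- A solution with vanishing initial value and vanishing right-hand side is zero. -/
theorem IsL2Solution.eq_zero (hΩ : (Ω : Set ℝ).OrdConnected) (hJ : IsUnit J)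
    (hjump : ∀ x ∈ Ω, IsUnit ((2 : ℂ) • J + jump q x) ∧ IsUnit ((2 : ℂ) • J - jump q x))
    {x₀ x : ℝ} (hx₀ : x₀ ∈ Ω) (hx : x ∈ Ω) {u : ℝ → Fin n → ℂ} (hu : IsL2Solution J q w u 0)
    (h0 : u x₀ = 0) : u x = 0 := by
  obtain ⟨C, -, hC⟩ := exists_bound (w := w) hΩ hJ hjump hx₀ hx
  have h := hC u 0 hu
  rw [h0] at h
  simpa using h

/-- The evaluation of a pair of the maximal relation is unique. -/
theorem IsEvaluation.eqOn (hΩ : (Ω : Set ℝ).OrdConnected) (hJ : IsUnit J)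
    (hjump : ∀ x ∈ Ω, IsUnit ((2 : ℂ) • J + jump q x) ∧ IsUnit ((2 : ℂ) • J - jump q x))
    {x₀ : ℝ} (hx₀ : x₀ ∈ Ω) {p : (weight w).L2 × (weight w).L2}
    {v v' : (weight w).L2Fun} (hv : IsEvaluation J q w x₀ p v)
    (hv' : IsEvaluation J q w x₀ p v') : Set.EqOn (v : ℝ → Fin n → ℂ) v' Ω := by
  intro x hx
  have h := hv.sub hv'
  rw [sub_self, isEvaluation_iff] at h
  obtain ⟨h1, ⟨f, hf, hs⟩, h2⟩ := h
  have hs0 : IsL2Solution J q w (v - v' : (weight w).L2Fun) 0 := hs.congr_right hf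
  have hz : ((v - v' : (weight w).L2Fun) : ℝ → Fin n → ℂ) ∈ zeroSolutions J q w :=
    mem_zeroSolutions_iff.mpr ⟨hs0, (MatrixWeight.toL2_eq_zero_iff _).mp h1⟩
  -- The difference lies in `𝓛₀`, so its value at `x₀` belongs to `N₀` and to `N₀ᗮ`.
  have h0 : ((v - v' : (weight w).L2Fun) : ℝ → Fin n → ℂ) x₀ = 0 :=
    dotProduct_star_self_eq_zero.mp (h2 _ hz)
  have hx0 : ((v - v' : (weight w).L2Fun) : ℝ → Fin n → ℂ) x = 0 :=
    hs0.eq_zero hΩ hJ hjump hx₀ hx h0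
  exact sub_eq_zero.mp hx0

/-- Every pair of the maximal relation has an evaluation. -/
theorem exists_isEvaluation {x₀ : ℝ} {p : (weight w).L2 × (weight w).L2}
    (hp : p ∈ Tmax J q w) : ∃ v, IsEvaluation J q w x₀ p v := by
  obtain ⟨u, f, hu, hf, hbv, hsol⟩ := hp
  let N : Submodule ℂ (EuclideanSpace ℂ (Fin n)) :=
    { carrier := {c | ∃ y ∈ zeroSolutions J q w, c = WithLp.toLp 2 (y x₀)}
      add_mem' := by
        rintro _ _ ⟨y, hy, rfl⟩ ⟨y', hy', rfl⟩
        exact ⟨y + y', zeroSolutions_add hy hy', rfl⟩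
      zero_mem' := ⟨0, zero_mem_zeroSolutions, rfl⟩
      smul_mem' := by
        rintro c _ ⟨y, hy, rfl⟩
        exact ⟨c • y, zeroSolutions_smul hy c, rfl⟩ }
  -- Here `y ∈ 𝓛₀` has as its value at `x₀` the orthogonal projection of `u x₀` onto `N₀`, so `u -
  -- y` is normalized.
  obtain ⟨y, hy, hyP⟩ := (N.starProjection_apply_mem (WithLp.toLp 2 (u x₀)))
  obtain ⟨y', hy', hy0⟩ := exists_L2Fun_of_mem_zeroSolutions hy
  refine ⟨u - y', isEvaluation_iff.mpr ⟨?_, ⟨f, hf, ?_⟩, fun z hz => ?_⟩⟩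
  · rw [MatrixWeight.toL2_sub, hu, hy0, sub_zero]
  · have h := (IsL2Solution.mk hbv hsol).sub (mem_zeroSolutions_iff.mp hy).1
    rw [sub_zero, ← hy'] at h
    exact h
  · have h := N.sub_starProjection_mem_orthogonal (WithLp.toLp 2 (u x₀))
    have h2 := (Submodule.mem_orthogonal _ _).mp h (WithLp.toLp 2 (z x₀)) ⟨z, hz, rfl⟩
    rw [hyP, ← WithLp.toLp_sub, EuclideanSpace.inner_toLp_toLp, dotProduct_comm] at h2
    change star (z x₀) ⬝ᵥ (u x₀ - (y' : ℝ → Fin n → ℂ) x₀) = 0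
    rw [hy']
    exact h2

end Linear

/-! ### Limits of solutions -/

section Limits

variable {Ω : Opens ℝ} {n : ℕ}

theorem isLocBounded_of_tendsto {v : ℕ → ℝ → Fin n → ℂ} {u : ℝ → Fin n → ℂ}
    (hv : ∀ m, IsLocBounded Ω (v m))
    (hbdd : ∀ K : Set ℝ, IsCompact K → K ⊆ Ω → ∃ C, 0 ≤ C ∧ ∀ m, ∀ x ∈ K, ‖v m x‖ ≤ C)
    (hlim : ∀ x ∈ Ω, Tendsto (fun m => v m x) atTop (𝓝 (u x))) : IsLocBounded Ω u := by
  refine ⟨measurable_of_tendsto_metrizable (fun m => (hv m).measurable) ?_, fun K hK hKΩ => ?_⟩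
  · refine tendsto_pi_nhds.mpr fun x => ?_
    by_cases hx : x ∈ (Ω : Set ℝ)
    · simpa [Set.indicator_of_mem hx] using hlim x hx
    · simp [Set.indicator_of_notMem hx]
  · obtain ⟨C, hC0, hC⟩ := hbdd K hK hKΩ
    exact ⟨C, hC0, fun x hx => le_of_tendsto (hlim x (hKΩ hx)).norm
      (Eventually.of_forall fun m => hC m x hx)⟩

theorem IsLocalDensity.tendsto_integral_mulVec {ν : Measure ℝ}
    {h : ℝ → Matrix (Fin n) (Fin n) ℂ} (hh : IsLocalDensity Ω ν h) {k : ℝ → ℝ}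
    (hk : IsCompactKernel Ω k) {v : ℕ → ℝ → Fin n → ℂ} {u : ℝ → Fin n → ℂ}
    (hv : ∀ m, IsLocBounded Ω (v m))
    (hbdd : ∀ K : Set ℝ, IsCompact K → K ⊆ Ω → ∃ C, 0 ≤ C ∧ ∀ m, ∀ x ∈ K, ‖v m x‖ ≤ C)
    (hlim : ∀ x ∈ Ω, Tendsto (fun m => v m x) atTop (𝓝 (u x))) (i : Fin n) :
    Tendsto (fun m => ∫ x, (k x : ℂ) * (h x *ᵥ v m x) i ∂ν) atTop
      (𝓝 (∫ x, (k x : ℂ) * (h x *ᵥ u x) i ∂ν)) := by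
  obtain ⟨B, hB⟩ := hk.bounded
  obtain ⟨K, hK, hKΩ, hk0⟩ := hk.support
  obtain ⟨C, hC0, hC⟩ := hbdd K hK hKΩ
  have hB0 : 0 ≤ B := (abs_nonneg _).trans (hB 0)
  refine tendsto_integral_of_dominated_convergence
    (K.indicator fun x => B * (entryNorm (h x) * C))
    (fun m => ((hh.locIntegrable_mulVec (hv m) i).integrable_mul hk).aestronglyMeasurable) ?_
    (fun m => Eventually.of_forall fun x => ?_) (Eventually.of_forall fun x => ?_)
  · exact (integrable_indicator_iff hK.measurableSet).mpr
      (((hh.integrableOn_entryNorm hK hKΩ).mul_const C).const_mul B)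
  · by_cases hx : x ∈ K
    · rw [Set.indicator_of_mem hx, norm_mul, Complex.norm_real]
      exact mul_le_mul (hB x) ((norm_mulVec_apply_le _ _ i).trans
        (mul_le_mul_of_nonneg_left (hC m x hx) (entryNorm_nonneg _))) (norm_nonneg _) hB0
    · rw [hk0 x hx, Set.indicator_of_notMem hx]
      simp
  · by_cases hx : x ∈ K
    · have hcont : Continuous fun c : Fin n → ℂ => (h x *ᵥ c) i :=
        (continuous_apply i).comp ((h x).mulVecLin.continuous_of_finiteDimensional)
      exact ((hcont.tendsto _).comp (hlim x (hKΩ hx))).const_mul _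
    · simp [hk0 x hx]

theorem jumpKernel_eq_ite {p t x : ℝ} : jumpKernel p t x =
    (if p < x then 1 else if p = x then 1 / 2 else 0) -
      (if t < x then 1 else if t = x then 1 / 2 else 0) := by
  unfold jumpKernel heaviside
  split_ifs <;> first | (norm_num; done) | (exfalso; grind)

/-- As `t` tends to `p` from one side, the integral over the interval between `p` and `t` tends to
the contribution of the half weight at `p`. -/
theorem LocIntegrable.tendsto_integral_jumpKernel {g : ℝ → ℂ} {μ : Measure ℝ}
    (hg : LocIntegrable Ω g μ) {p : ℝ} (hp : p ∈ Ω) {s : Set ℝ} {σ : ℝ}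
    (hs : ∀ x, ∀ᶠ t in 𝓝[s] p, jumpKernel p t x = if x = p then σ else 0) :
    Tendsto (fun t => ∫ x, (jumpKernel p t x : ℂ) * g x ∂μ) (𝓝[s] p)
      (𝓝 ((σ : ℂ) * (μ.real {p} * g p))) := by
  obtain ⟨δ, hδ, hsub⟩ := Metric.isOpen_iff.mp Ω.isOpen p hp
  have hI : Set.Icc (p - δ / 2) (p + δ / 2) ⊆ Ω := fun x hx => hsub (by
    rw [Metric.mem_ball, Real.dist_eq, abs_lt]
    exact ⟨by linarith [hx.1], by linarith [hx.2]⟩)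
  have hpI : p ∈ Set.Icc (p - δ / 2) (p + δ / 2) := ⟨by linarith, by linarith⟩
  have hval : ∫ x, ((if x = p then σ else 0 : ℝ) : ℂ) * g x ∂μ =
      (σ : ℂ) * (μ.real {p} * g p) := by
    have : (fun x => ((if x = p then σ else 0 : ℝ) : ℂ) * g x) =
        ({p} : Set ℝ).indicator fun x => (σ : ℂ) * g x := by
      funext x
      by_cases hx : x = p <;> simp [hx]
    rw [this, integral_indicator (measurableSet_singleton p), integral_singleton,
      Complex.real_smul]
    ring
  rw [← hval]
  have hgi := hg _ isCompact_Icc hI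
  have hev : ∀ᶠ t in 𝓝[s] p, t ∈ Set.Icc (p - δ / 2) (p + δ / 2) :=
    nhdsWithin_le_nhds (Icc_mem_nhds (by linarith) (by linarith))
  refine tendsto_integral_filter_of_dominated_convergence
    ((Set.Icc (p - δ / 2) (p + δ / 2)).indicator fun x => ‖g x‖) ?_ ?_
    ((integrable_indicator_iff measurableSet_Icc).mpr hgi.norm) ?_
  · filter_upwards [hev] with t ht
    exact (hg.integrable_mul ⟨measurable_jumpKernel p t, ⟨1, abs_jumpKernel_le p t⟩, _,
      isCompact_Icc, hI, fun x hx => jumpKernel_eq_zero hpI ht hx⟩).aestronglyMeasurable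
  · filter_upwards [hev] with t ht
    refine Eventually.of_forall fun x => ?_
    by_cases hx : x ∈ Set.Icc (p - δ / 2) (p + δ / 2)
    · rw [Set.indicator_of_mem hx, norm_mul, Complex.norm_real]
      exact mul_le_of_le_one_left (norm_nonneg _) (abs_jumpKernel_le p t x)
    · simp [jumpKernel_eq_zero hpI ht hx, Set.indicator_of_notMem hx]
  · refine Eventually.of_forall fun x => ?_
    refine tendsto_const_nhds.congr' ?_
    filter_upwards [hs x] with t ht
    rw [ht]

theorem eventually_jumpKernel_right (p x : ℝ) :
    ∀ᶠ t in 𝓝[>] p, jumpKernel p t x = if x = p then (1 / 2 : ℝ) else 0 := by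
  rcases lt_or_ge p x with hx | hx
  · filter_upwards [Ioo_mem_nhdsGT hx] with t ht
    simp [jumpKernel_eq_ite, ht.2, hx, hx.ne']
  · filter_upwards [self_mem_nhdsWithin] with t ht
    have h1 : ¬ t < x := not_lt.mpr (hx.trans (le_of_lt ht))
    have h2 : t ≠ x := (hx.trans_lt ht).ne'
    simp [jumpKernel_eq_ite, h1, h2, hx.not_gt, eq_comm]

theorem eventually_jumpKernel_left (p x : ℝ) :
    ∀ᶠ t in 𝓝[<] p, jumpKernel p t x = if x = p then (-(1 / 2) : ℝ) else 0 := by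
  rcases lt_or_ge x p with hx | hx
  · filter_upwards [Ioo_mem_nhdsLT hx] with t ht
    simp [jumpKernel_eq_ite, ht.1.not_gt, ht.1.ne', hx.not_gt, hx.ne, hx.ne']
  · filter_upwards [self_mem_nhdsWithin] with t ht
    have h1 : t < x := lt_of_lt_of_le ht hx
    rcases hx.eq_or_lt with rfl | hx
    · simp only [jumpKernel_eq_ite, h1, lt_irrefl, if_true, if_false]
      norm_num
    · simp [jumpKernel_eq_ite, h1, hx, hx.ne']

/-- Locally bounded solutions of the homogeneous integral equation are balanced and of locally
bounded variation. -/
theorem isBalancedBV_of_integral_equation (hΩ : (Ω : Set ℝ).OrdConnected)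
    {J : Matrix (Fin n) (Fin n) ℂ} (hJ : IsUnit J) {ν : Measure ℝ}
    {h : ℝ → Matrix (Fin n) (Fin n) ℂ} (hh : IsLocalDensity Ω ν h) {u : ℝ → Fin n → ℂ}
    (hu : IsLocBounded Ω u)
    (heq : ∀ s ∈ Ω, ∀ t ∈ Ω, ∀ i, (J *ᵥ u t) i - (J *ᵥ u s) i =
      -∫ x, (jumpKernel s t x : ℂ) * (h x *ᵥ u x) i ∂ν) : IsBalancedBV Ω u := by
  have hinv : ∀ c, J⁻¹ *ᵥ (J *ᵥ c) = c := fun c => by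
    rw [mulVec_mulVec, nonsing_inv_mul _ ((Matrix.isUnit_iff_isUnit_det _).mp hJ), one_mulVec]
  refine ⟨fun a b ha hb => ?_, fun p hp => ?_⟩
  · have hab : Set.uIcc a b ⊆ (Ω : Set ℝ) := hΩ.uIcc_subset ha hb
    obtain ⟨C, hC0, hC⟩ := hu.bounded _ isCompact_uIcc hab
    have hint : ∀ s ∈ Set.uIcc a b, ∀ t ∈ Set.uIcc a b,
        Integrable (fun x => jumpKernel s t x * (entryNorm (h x) * C)) ν := by
      intro s hs t ht
      have h1 : IntegrableOn (fun x => jumpKernel s t x * (entryNorm (h x) * C))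
          (Set.uIcc a b) ν :=
        ((hh.integrableOn_entryNorm isCompact_uIcc hab).mul_const C).bdd_mul (c := 1)
          (measurable_jumpKernel s t).aestronglyMeasurable
          (Eventually.of_forall fun x => abs_jumpKernel_le s t x)
      exact h1.integrable_of_forall_notMem_eq_zero fun x hx => by
        rw [jumpKernel_eq_zero hs ht hx, zero_mul]
    -- A monotone majorant: increments of `u` are bounded by those of `m`, hence so is the
    -- variation.
    set m : ℝ → ℝ := fun t =>
      entryNorm J⁻¹ * ∫ x, jumpKernel a t x * (entryNorm (h x) * C) ∂ν with hm
    have hdiff : ∀ s ∈ Set.uIcc a b, ∀ t ∈ Set.uIcc a b, m t - m s =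
        entryNorm J⁻¹ * ∫ x, jumpKernel s t x * (entryNorm (h x) * C) ∂ν := by
      intro s hs t ht
      rw [hm]
      simp only
      rw [← mul_sub, ← integral_sub (hint a Set.left_mem_uIcc t ht)
        (hint a Set.left_mem_uIcc s hs)]
      congr 2
      funext x
      rw [← jumpKernel_add a s t x]
      ring
    have hmono : ∀ s ∈ Set.uIcc a b, ∀ t ∈ Set.uIcc a b, s ≤ t → ‖u t - u s‖ ≤ m t - m s := by
      intro s hs t ht hst
      rw [hdiff s hs t ht]
      have hnn : 0 ≤ ∫ x, jumpKernel s t x * (entryNorm (h x) * C) ∂ν :=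
        integral_nonneg fun x => mul_nonneg (jumpKernel_nonneg hst x)
          (mul_nonneg (entryNorm_nonneg _) hC0)
      refine (norm_le_of_isUnit hJ _).trans (mul_le_mul_of_nonneg_left ?_ (entryNorm_nonneg _))
      refine (pi_norm_le_iff_of_nonneg hnn).mpr fun i => ?_
      rw [mulVec_sub, Pi.sub_apply, heq s (hab hs) t (hab ht) i, norm_neg]
      refine norm_integral_le_of_norm_le (hint s hs t ht) (Eventually.of_forall fun x => ?_)
      rw [norm_mul, Complex.norm_real, Real.norm_of_nonneg (jumpKernel_nonneg hst x)]
      by_cases hx : x ∈ Set.uIcc a b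
      · exact mul_le_mul_of_nonneg_left ((norm_mulVec_apply_le _ _ i).trans
          (mul_le_mul_of_nonneg_left (hC x hx) (entryNorm_nonneg _))) (jumpKernel_nonneg hst x)
      · rw [jumpKernel_eq_zero hs ht hx, zero_mul, zero_mul]
    have hsub : (Ω : Set ℝ) ∩ Set.Icc a b ⊆ Set.uIcc a b := fun x hx => Set.Icc_subset_uIcc hx.2
    have hmm : MonotoneOn m (Set.uIcc a b) := fun s hs t ht hst =>
      sub_nonneg.mp ((norm_nonneg _).trans (hmono s hs t ht hst))
    have hmv := hmm.locallyBoundedVariationOn a b Set.left_mem_uIcc Set.right_mem_uIcc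
    refine ne_top_of_le_ne_top hmv ?_
    refine iSup_le fun r => ?_
    have hr : ∀ i, r.2.1 i ∈ Set.uIcc a b := fun i => hsub (r.2.2.2 i)
    refine le_trans ?_ (eVariationOn.sum_le (f := m) (s := Set.uIcc a b ∩ Set.Icc a b)
      (n := r.1) r.2.2.1 fun i => ⟨hr i, (r.2.2.2 i).2⟩)
    refine Finset.sum_le_sum fun i _ => ?_
    have hle := hmono _ (hr i) _ (hr (i + 1)) (r.2.2.1 (Nat.le_succ i))
    rw [edist_dist, edist_dist, dist_eq_norm, Real.dist_eq]
    exact ENNReal.ofReal_le_ofReal (hle.trans (le_abs_self _))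
  · have hcont : Continuous fun c : Fin n → ℂ => J⁻¹ *ᵥ c :=
      J⁻¹.mulVecLin.continuous_of_finiteDimensional
    -- Both one-sided limits come from one formula, with `σ = -1/2` on the left and `σ = 1/2` on the
    -- right. Their mean is `u p`.
    have key : ∀ (s : Set ℝ) (σ : ℝ),
        (∀ x, ∀ᶠ t in 𝓝[s] p, jumpKernel p t x = if x = p then σ else 0) →
        Tendsto u (𝓝[s] p)
          (𝓝 (J⁻¹ *ᵥ (J *ᵥ u p - ((σ * ν.real {p} : ℝ) : ℂ) • (h p *ᵥ u p)))) := by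
      intro s σ hs
      have hlim : Tendsto (fun t => J *ᵥ u t) (𝓝[s] p)
          (𝓝 (J *ᵥ u p - ((σ * ν.real {p} : ℝ) : ℂ) • (h p *ᵥ u p))) := by
        refine tendsto_pi_nhds.mpr fun i => ?_
        have h1 := ((hh.locIntegrable_mulVec hu i).tendsto_integral_jumpKernel hp hs).const_sub
          ((J *ᵥ u p) i)
        have h2 : (J *ᵥ u p - ((σ * ν.real {p} : ℝ) : ℂ) • (h p *ᵥ u p)) i =
            (J *ᵥ u p) i - (σ : ℂ) * (ν.real {p} * (h p *ᵥ u p) i) := by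
          rw [Pi.sub_apply, Pi.smul_apply, smul_eq_mul]
          push_cast
          ring
        rw [h2]
        refine h1.congr' ?_
        filter_upwards [nhdsWithin_le_nhds (Ω.isOpen.mem_nhds hp)] with t ht
        have := heq p hp t ht i
        linear_combination -this
      refine ((hcont.tendsto _).comp hlim).congr fun t => ?_
      exact hinv (u t)
    refine ⟨_, _, key _ _ (eventually_jumpKernel_left p), key _ _ (eventually_jumpKernel_right p),
      ?_⟩
    rw [← mulVec_add, ← mulVec_smul]
    have : (1 / 2 : ℂ) • (J *ᵥ u p - ((1 / 2 * ν.real {p} : ℝ) : ℂ) • (h p *ᵥ u p) +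
        (J *ᵥ u p - ((-(1 / 2) * ν.real {p} : ℝ) : ℂ) • (h p *ᵥ u p))) = J *ᵥ u p := by
      funext i
      simp only [Pi.smul_apply, Pi.add_apply, Pi.sub_apply, smul_eq_mul]
      push_cast
      ring
    rw [this, hinv]

variable {J : Matrix (Fin n) (Fin n) ℂ} {q w : DistMatrix Ω n}

/-- If evaluations of pairs which tend to zero converge at `x₀`, then they converge to zero
everywhere. -/
theorem tendsto_zero_of_isEvaluation (hΩ : (Ω : Set ℝ).OrdConnected) (hJ : IsUnit J)
    (hjump : ∀ x ∈ Ω, IsUnit ((2 : ℂ) • J + jump q x) ∧ IsUnit ((2 : ℂ) • J - jump q x))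
    {x₀ : ℝ} (hx₀ : x₀ ∈ Ω) {e : ℕ → (weight w).L2Fun} {p : ℕ → (weight w).L2 × (weight w).L2}
    (he : ∀ m, IsEvaluation J q w x₀ (p m) (e m)) (hp : Tendsto p atTop (𝓝 0)) {c : Fin n → ℂ}
    (hc : Tendsto (fun m => (e m : ℝ → Fin n → ℂ) x₀) atTop (𝓝 c)) :
    c = 0 ∧ ∀ x ∈ Ω, Tendsto (fun m => (e m : ℝ → Fin n → ℂ) x) atTop (𝓝 0) := by
  have hq := isLocalDensity_coeffMeasure q
  have hw := isLocalDensity_weight w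
  choose he1 hef horth using fun m => isEvaluation_iff.mp (he m)
  choose f hf hs using hef
  have hp1 : Tendsto (fun m => ‖e m‖) atTop (𝓝 0) := by
    have h := (continuous_fst.tendsto _).comp hp
    refine (tendsto_zero_iff_norm_tendsto_zero.mp h).congr fun m => ?_
    rw [Function.comp_apply, ← he1, MatrixWeight.norm_toL2]
  have hp2 : Tendsto (fun m => ‖f m‖) atTop (𝓝 0) := by
    have h := (continuous_snd.tendsto _).comp hp
    refine (tendsto_zero_iff_norm_tendsto_zero.mp h).congr fun m => ?_
    rw [Function.comp_apply, ← hf, MatrixWeight.norm_toL2]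
  have hbdd : ∀ K : Set ℝ, IsCompact K → K ⊆ Ω →
      ∃ C, 0 ≤ C ∧ ∀ m, ∀ x ∈ K, ‖(e m : ℝ → Fin n → ℂ) x‖ ≤ C := by
    intro K hK hKΩ
    obtain ⟨C, hC0, hC⟩ := exists_bound_on_compact (w := w) hΩ hJ hjump hx₀ hK hKΩ
    obtain ⟨B, hB⟩ := (hc.norm.add hp2).bddAbove_range
    have hB' : ∀ m, ‖(e m : ℝ → Fin n → ℂ) x₀‖ + ‖f m‖ ≤ B := fun m => hB ⟨m, rfl⟩
    have hB0 : 0 ≤ B := le_trans (by positivity) (hB' 0)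
    exact ⟨C * B, by positivity, fun m x hx =>
      (hC _ _ (hs m) x hx).trans (mul_le_mul_of_nonneg_left (hB' m) hC0)⟩
  have hex : ∀ x, ∃ l, x ∈ Ω → Tendsto (fun m => (e m : ℝ → Fin n → ℂ) x) atTop (𝓝 l) := by
    intro x
    by_cases hx : x ∈ Ω
    swap
    · exact ⟨0, fun h => absurd h hx⟩
    obtain ⟨C, hC0, hC⟩ := exists_bound (w := w) hΩ hJ hjump hx₀ hx
    -- Differences of solutions are solutions, so the a priori bound transfers the Cauchy property
    -- from `x₀` to `x`. Using `C + 1` keeps the denominators positive.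
    have hcau : CauchySeq fun m => (e m : ℝ → Fin n → ℂ) x := by
      rw [Metric.cauchySeq_iff']
      intro ε hε
      have hC1 : 0 < C + 1 := by linarith
      obtain ⟨N₁, hN₁⟩ := Metric.cauchySeq_iff'.mp hc.cauchySeq (ε / (2 * (C + 1)))
        (by positivity)
      obtain ⟨N₂, hN₂⟩ := (hp2.eventually_lt_const
        (show (0 : ℝ) < ε / (8 * (C + 1)) by positivity)).exists_forall_of_atTop
      obtain ⟨N₃, hN₃⟩ := Metric.cauchySeq_iff.mp hc.cauchySeq (ε / (4 * (C + 1)))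
        (by positivity)
      refine ⟨max N₂ N₃, fun m hm => ?_⟩
      have h1 := hC _ _ ((hs m).sub (hs (max N₂ N₃)))
      have h2 := hN₃ m (le_of_max_le_right hm) (max N₂ N₃) (le_max_right _ _)
      have h3 := hN₂ m (le_of_max_le_left hm)
      have h4 := hN₂ (max N₂ N₃) (le_max_left _ _)
      have h5 := norm_sub_le (f m) (f (max N₂ N₃))
      rw [dist_eq_norm] at h2 ⊢
      simp only [Pi.sub_apply] at h1
      refine lt_of_le_of_lt h1 ?_
      have h6 : ‖(e m : ℝ → Fin n → ℂ) x₀ - (e (max N₂ N₃) : ℝ → Fin n → ℂ) x₀‖ +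
          ‖f m - f (max N₂ N₃)‖ ≤ ε / (2 * (C + 1)) := by
        have e1 : ε / (2 * (C + 1)) =
            ε / (4 * (C + 1)) + (ε / (8 * (C + 1)) + ε / (8 * (C + 1))) := by
          field_simp
          norm_num
        linarith
      calc _ ≤ C * (ε / (2 * (C + 1))) := mul_le_mul_of_nonneg_left h6 hC0
        _ ≤ (C + 1) * (ε / (2 * (C + 1))) :=
            mul_le_mul_of_nonneg_right (by linarith) (by positivity)
        _ = ε / 2 := by field_simp
        _ < ε := half_lt_self hε
    obtain ⟨l, hl⟩ := cauchySeq_tendsto_of_complete hcau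
    exact ⟨l, fun _ => hl⟩
  choose u hu using hex
  have hloc : ∀ m, IsLocBounded Ω (e m : ℝ → Fin n → ℂ) := fun m => (hs m).bv.isLocBounded
  have huloc := isLocBounded_of_tendsto hloc hbdd hu
  have hpair : ∀ {g : ℕ → (weight w).L2Fun}, Tendsto (fun m => ‖g m‖) atTop (𝓝 0) →
      ∀ {k : ℝ → ℝ}, IsCompactKernel Ω k → ∀ i, Tendsto (fun m =>
        ∫ x, (k x : ℂ) * ((weight w).W x *ᵥ g m x) i ∂(weight w).S) atTop (𝓝 0) := by
    intro g hg k hk i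
    refine squeeze_zero_norm (a := fun m => ‖MatrixWeight.single hw hk i‖ * ‖g m‖)
      (fun m => ?_) (by simpa using hg.const_mul ‖MatrixWeight.single hw hk i‖)
    rw [← MatrixWeight.inner_single hw hk i]
    exact norm_inner_le_norm _ _
  -- Pointwise limits need not be balanced or of bounded variation. The integral equation does pass
  -- to the limit, and it supplies both properties.
  have hubv : IsBalancedBV Ω u := by
    refine isBalancedBV_of_integral_equation hΩ hJ hq huloc fun s hs' t ht i => ?_
    have hk := isCompactKernel_jumpKernel hΩ hs' ht
    have hcont : Continuous fun v : Fin n → ℂ => (J *ᵥ v) i :=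
      (continuous_apply i).comp (J.mulVecLin.continuous_of_finiteDimensional)
    have h1 := ((hcont.tendsto _).comp (hu t ht)).sub ((hcont.tendsto _).comp (hu s hs'))
    have h2 := (hq.tendsto_integral_mulVec hk hloc hbdd hu i).neg.add (hpair hp2 hk i)
    rw [add_zero] at h2
    refine tendsto_nhds_unique h1 (h2.congr fun m => ?_)
    exact (integral_equation hΩ (f m) (hs m).bv (hs m).eq hs' ht i).symm
  have husol : IsSolution J q w u 0 := by
    intro φ i
    have hφ := isCompactKernel_testFunction φ
    have h1 := ((isLocalDensity_const J).tendsto_integral_mulVec (isCompactKernel_deriv φ) hloc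
      hbdd hu i).neg.add (hq.tendsto_integral_mulVec hφ hloc hbdd hu i)
    have h2 := (hpair hp2 hφ i).congr fun m => ((hs m).eq φ i).symm
    rw [tendsto_nhds_unique h1 h2]
    simp
  -- The norms of the `e m` tend to zero, so `W u` vanishes as a distribution.
  have huz : u ∈ zeroSolutions J q w := by
    refine ⟨hubv, husol, fun φ i => ?_⟩
    have hφ := isCompactKernel_testFunction φ
    exact tendsto_nhds_unique (hw.tendsto_integral_mulVec hφ hloc hbdd hu i) (hpair hp1 hφ i)
  have huc : u x₀ = c := tendsto_nhds_unique (hu x₀ hx₀) hc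
  -- Each `e m x₀` is orthogonal to `u x₀ ∈ N₀`. In the limit `c = u x₀` is orthogonal to itself.
  have hdot : star (u x₀) ⬝ᵥ c = 0 := by
    have hcont : Continuous fun v : Fin n → ℂ => star (u x₀) ⬝ᵥ v := by
      unfold dotProduct
      fun_prop
    exact tendsto_nhds_unique ((hcont.tendsto c).comp hc)
      (tendsto_const_nhds.congr fun m => (horth m u huz).symm)
  have hc0 : c = 0 := by
    rw [huc] at hdot
    exact dotProduct_star_self_eq_zero.mp hdot
  refine ⟨hc0, fun x hx => ?_⟩
  have h0 : u x = 0 := IsL2Solution.eq_zero (w := w) hΩ hJ hjump hx₀ hx ⟨hubv, husol⟩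
    (huc.trans hc0)
  rw [← h0]
  exact hu x hx

end Limits

/-! ### The resolvent and its kernel -/

section Resolvent

theorem ordConnected_interval (a b : EReal) : (interval a b : Set ℝ).OrdConnected :=
  ⟨fun _ hx _ hy _ ht =>
    ⟨hx.1.trans_le (EReal.coe_le_coe_iff.mpr ht.1), (EReal.coe_le_coe_iff.mpr ht.2).trans_lt hy.2⟩⟩

/-- An adjoint relation is an intersection of zero sets of continuous functions, one for each pair
in `T`. -/
theorem isClosed_of_adjoint_eq {H : Type*} [NormedAddCommGroup H] [InnerProductSpace ℂ H]
    {T : Submodule ℂ (H × H)} (hT : T.adjoint = T) : IsClosed (T : Set (H × H)) := by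
  have h : (T : Set (H × H)) =
      ⋂ p : T, {x : H × H | inner ℂ p.1.2 x.1 - inner ℂ p.1.1 x.2 = 0} := by
    ext x
    rw [SetLike.mem_coe, ← hT, Submodule.mem_adjoint_iff, hT, Set.mem_iInter]
    exact ⟨fun h p => h p.1.1 p.1.2 p.2, fun h a b hab => h ⟨(a, b), hab⟩⟩
  rw [h]
  exact isClosed_iInter fun p => isClosed_eq (by fun_prop) continuous_const

variable {Ω : Opens ℝ} {n : ℕ} {J : Matrix (Fin n) (Fin n) ℂ} {q w : DistMatrix Ω n}

theorem resolvent_unique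
    {T : Submodule ℂ ((weight w).L2 × (weight w).L2)} {z : ℂ} (hz : z ∈ relResolventSet T)
    {f u u' : (weight w).L2} (hu : (u, z • u + f) ∈ T) (hu' : (u', z • u' + f) ∈ T) : u = u' := by
  refine sub_eq_zero.mp (hz.1 (u - u') (z • u + f - (z • u' + f)) (T.sub_mem hu hu') ?_)
  rw [smul_sub]
  abel

theorem exists_resolvent {T : Submodule ℂ ((weight w).L2 × (weight w).L2)} {z : ℂ}
    (hz : z ∈ relResolventSet T) (f : (weight w).L2) : ∃ u, (u, z • u + f) ∈ T := by
  obtain ⟨u, g, hg, rfl⟩ := hz.2 f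
  exact ⟨u, by rwa [add_sub_cancel]⟩

/-- The relation between `f`, the values at `x₀` and `x` of `E_z f`, and `(T - z)⁻¹ f`. -/
def resolventGraph (J : Matrix (Fin n) (Fin n) ℂ) (q w : DistMatrix Ω n) (x₀ : ℝ)
    (T : Submodule ℂ ((weight w).L2 × (weight w).L2)) (z : ℂ) (x : ℝ) :
    Submodule ℂ ((weight w).L2 × (Fin n → ℂ) × (Fin n → ℂ) × (weight w).L2) where
  carrier := {y | (y.2.2.2, z • y.2.2.2 + y.1) ∈ T ∧ ∃ v : (weight w).L2Fun,
    IsEvaluation J q w x₀ (y.2.2.2, z • y.2.2.2 + y.1) v ∧ v x₀ = y.2.1 ∧ v x = y.2.2.1}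
  add_mem' := by
    rintro y y' ⟨hT, v, hv, h0, h1⟩ ⟨hT', v', hv', h0', h1'⟩
    have e : ((y + y').2.2.2, z • (y + y').2.2.2 + (y + y').1) =
        (y.2.2.2, z • y.2.2.2 + y.1) + (y'.2.2.2, z • y'.2.2.2 + y'.1) := by
      refine Prod.ext rfl ?_
      simp only [Prod.snd_add, Prod.fst_add, smul_add]
      abel
    refine ⟨e ▸ T.add_mem hT hT', v + v', e ▸ hv.add hv', ?_, ?_⟩
    · exact congrArg₂ (· + ·) h0 h0'
    · exact congrArg₂ (· + ·) h1 h1'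
  zero_mem' := by
    have e : ((0 : (weight w).L2), z • (0 : (weight w).L2) + 0) = 0 := by
      rw [smul_zero, add_zero]; rfl
    refine ⟨e ▸ T.zero_mem, 0, ?_, rfl, rfl⟩
    change IsEvaluation J q w x₀ ((0 : (weight w).L2), z • (0 : (weight w).L2) + 0) 0
    rw [e, isEvaluation_iff]
    exact ⟨rfl, ⟨0, rfl, (mem_zeroSolutions_iff.mp zero_mem_zeroSolutions).1⟩,
      fun y _ => dotProduct_zero _⟩
  smul_mem' := by
    rintro c y ⟨hT, v, hv, h0, h1⟩
    have e : ((c • y).2.2.2, z • (c • y).2.2.2 + (c • y).1) = c • (y.2.2.2, z • y.2.2.2 + y.1) := by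
      refine Prod.ext rfl ?_
      simp only [Prod.smul_snd, Prod.smul_fst, smul_add]
      rw [smul_comm]
    refine ⟨e ▸ T.smul_mem c hT, c • v, e ▸ hv.smul c, ?_, ?_⟩
    · exact congrArg (c • ·) h0
    · exact congrArg (c • ·) h1

theorem isClosed_resolventGraph (hΩ : (Ω : Set ℝ).OrdConnected) (hJ : IsUnit J)
    (hjump : ∀ x ∈ Ω, IsUnit ((2 : ℂ) • J + jump q x) ∧ IsUnit ((2 : ℂ) • J - jump q x))
    {x₀ x : ℝ} (hx₀ : x₀ ∈ Ω) (hx : x ∈ Ω) {T : Submodule ℂ ((weight w).L2 × (weight w).L2)}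
    (hT : IsClosed (T : Set ((weight w).L2 × (weight w).L2)))
    (hTmax : (T : Set ((weight w).L2 × (weight w).L2)) ⊆ Tmax J q w) (z : ℂ) :
    IsClosed (resolventGraph J q w x₀ T z x :
      Set ((weight w).L2 × (Fin n → ℂ) × (Fin n → ℂ) × (weight w).L2)) := by
  refine IsSeqClosed.isClosed fun y y' hy hlim => ?_
  choose hyT v hv h0 h1 using hy
  have hF : Continuous fun y : (weight w).L2 × (Fin n → ℂ) × (Fin n → ℂ) × (weight w).L2 =>
      (y.2.2.2, z • y.2.2.2 + y.1) := by fun_prop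
  have hp := (hF.tendsto y').comp hlim
  have hy'T : (y'.2.2.2, z • y'.2.2.2 + y'.1) ∈ T :=
    hT.mem_of_tendsto hp (Eventually.of_forall hyT)
  obtain ⟨v', hv'⟩ := exists_isEvaluation (x₀ := x₀) (hTmax hy'T)
  have hc : Tendsto (fun m => (v m : ℝ → Fin n → ℂ) x₀) atTop (𝓝 y'.2.1) := by
    simp only [h0]
    exact ((continuous_fst.comp continuous_snd).tendsto y').comp hlim
  have hd : Tendsto (fun m => (v m : ℝ → Fin n → ℂ) x) atTop (𝓝 y'.2.2.1) := by
    simp only [h1]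
    exact ((continuous_fst.comp (continuous_snd.comp continuous_snd)).tendsto y').comp hlim
  -- The differences `v m - v'` evaluate pairs tending to zero. They converge at `x₀` because the
  -- value at `x₀` is a coordinate of the graph, which is why it was included.
  obtain ⟨hc0, hall⟩ := tendsto_zero_of_isEvaluation hΩ hJ hjump hx₀
    (fun m => (hv m).sub hv') (by simpa using hp.sub_const (y'.2.2.2, z • y'.2.2.2 + y'.1))
    (hc.sub_const ((v' : ℝ → Fin n → ℂ) x₀))
  have hd0 := tendsto_nhds_unique (hall x hx) (hd.sub_const ((v' : ℝ → Fin n → ℂ) x))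
  exact ⟨hy'T, v', hv', (sub_eq_zero.mp hc0).symm, (sub_eq_zero.mp hd0.symm).symm⟩

/-- The value of `E_z f` at `x` depends continuously on `f`. -/
theorem exists_continuous_evaluation (hΩ : (Ω : Set ℝ).OrdConnected) (hJ : IsUnit J)
    (hjump : ∀ x ∈ Ω, IsUnit ((2 : ℂ) • J + jump q x) ∧ IsUnit ((2 : ℂ) • J - jump q x))
    {x₀ x : ℝ} (hx₀ : x₀ ∈ Ω) (hx : x ∈ Ω) {T : Submodule ℂ ((weight w).L2 × (weight w).L2)}
    (hT : IsClosed (T : Set ((weight w).L2 × (weight w).L2)))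
    (hTmax : (T : Set ((weight w).L2 × (weight w).L2)) ⊆ Tmax J q w) {z : ℂ}
    (hz : z ∈ relResolventSet T) :
    ∃ E : (weight w).L2 →L[ℂ] (Fin n → ℂ), ∀ f v : (weight w).L2Fun,
      IsResolventEval J q w x₀ T z f v → v x = E ((weight w).toL2 f) := by
  have hcl := isClosed_resolventGraph hΩ hJ hjump hx₀ hx hT hTmax z
  have : CompleteSpace (resolventGraph J q w x₀ T z x) := hcl.completeSpace_coe
  let P : resolventGraph J q w x₀ T z x →L[ℂ] (weight w).L2 :=
    (ContinuousLinearMap.fst ℂ _ _).comp (resolventGraph J q w x₀ T z x).subtypeL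
  -- With `f = 0`, the condition on `ker (T - z)` gives `u = 0`. Then `v` and `0 • v` both evaluate
  -- the zero pair, so `v` vanishes on `Ω` by uniqueness.
  have hinj : P.ker = ⊥ := by
    rw [LinearMap.ker_eq_bot']
    rintro ⟨⟨f, c, d, u⟩, hT', v, hv, h0, h1⟩ hf
    have hf0 : f = 0 := hf
    subst hf0
    have hu : u = 0 := hz.1 u (z • u + 0) hT' (by simp)
    subst hu
    have e : ((0 : (weight w).L2), z • (0 : (weight w).L2) + 0) = 0 := by
      rw [smul_zero, add_zero]; rfl
    simp only at hv h0 h1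
    rw [e] at hv
    have hv0 := hv.smul 0
    rw [smul_zero] at hv0
    have heq := hv.eqOn hΩ hJ hjump hx₀ hv0
    have hzero : ∀ t, ((0 : ℂ) • v : (weight w).L2Fun) t = 0 := fun t => zero_smul ℂ (v t)
    have hc : c = 0 := by rw [← h0, heq hx₀, hzero]
    have hd : d = 0 := by rw [← h1, heq hx, hzero]
    subst hc hd
    rfl
  have hsurj : P.range = ⊤ := by
    rw [LinearMap.range_eq_top]
    intro f
    obtain ⟨u, hu⟩ := exists_resolvent hz f
    obtain ⟨v, hv⟩ := exists_isEvaluation (x₀ := x₀) (hTmax hu)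
    exact ⟨⟨(f, v x₀, v x, u), hu, v, hv, rfl, rfl⟩, rfl⟩
  -- The open mapping theorem: a continuous linear bijection of Banach spaces has a continuous
  -- inverse. Composing with the coordinate `v x` gives the evaluation.
  let e := ContinuousLinearEquiv.ofBijective P hinj hsurj
  let D : resolventGraph J q w x₀ T z x →L[ℂ] (Fin n → ℂ) :=
    (ContinuousLinearMap.fst ℂ _ _).comp ((ContinuousLinearMap.snd ℂ _ _).comp
      ((ContinuousLinearMap.snd ℂ _ _).comp (resolventGraph J q w x₀ T z x).subtypeL))
  refine ⟨D.comp (e.symm : (weight w).L2 →L[ℂ] resolventGraph J q w x₀ T z x), ?_⟩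
  rintro f v ⟨u, hu, hv⟩
  let y : resolventGraph J q w x₀ T z x :=
    ⟨((weight w).toL2 f, v x₀, v x, u), hu, v, hv, rfl, rfl⟩
  have hy : e.symm ((weight w).toL2 f) = y := e.symm_apply_eq.mpr rfl
  change v x = D (e.symm ((weight w).toL2 f))
  rw [hy]
  rfl

/-- A continuous linear map from `L²(w)` to `ℂⁿ` is given by a matrix-valued kernel. -/
theorem MatrixWeight.exists_kernel (ω : MatrixWeight n) (E : ω.L2 →L[ℂ] (Fin n → ℂ)) :
    ∃ G : ℝ → Matrix (Fin n) (Fin n) ℂ, (∀ j : Fin n, ω.MemL2 fun y => (G y)ᴴ.col j) ∧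
      ∀ (f : ω.L2Fun) (i : Fin n),
        E (ω.toL2 f) i = ∫ y, (G y *ᵥ (ω.W y *ᵥ f y)) i ∂ω.S := by
  have h : ∀ i, ∃ g : ω.L2Fun, ∀ f : ω.L2Fun, E (ω.toL2 f) i = inner ℂ g f := by
    intro i
    obtain ⟨g, hg⟩ := ω.toL2_surjective ((InnerProductSpace.toDual ℂ ω.L2).symm
      ((ContinuousLinearMap.proj i : (Fin n → ℂ) →L[ℂ] ℂ).comp E))
    refine ⟨g, fun f => ?_⟩
    rw [← MatrixWeight.inner_toL2, hg, InnerProductSpace.toDual_symm_apply]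
    rfl
  choose g hg using h
  -- Row `i` of the kernel is the adjoint of the Riesz vector `g i`, so the columns of `Gᴴ` are the
  -- `g i` themselves.
  refine ⟨fun y => Matrix.of fun i k => star (g i y k), fun j => ?_, fun f i => ?_⟩
  · have hcol : (fun y => (Matrix.of fun i k => star ((g i : ℝ → Fin n → ℂ) y k))ᴴ.col j) =
        (g j : ℝ → Fin n → ℂ) := by
      funext y k
      simp [Matrix.col]
    rw [hcol]
    exact (g j).2
  · rw [hg i f]
    rfl

end Resolvent

end DistSystem

open DistSystem
theorem mainTheorem12 (n : ℕ) (a b : EReal) (hab : a < b)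
    (J : Matrix (Fin n) (Fin n) ℂ) (hJ : IsUnit J) (hJskew : Jᴴ = -J)
    (q w : DistMatrix (interval a b) n) (hq : IsHermitianDist q) (hw : IsNonnegDist w)
    (hjump : ∀ x ∈ interval a b,
      IsUnit ((2 : ℂ) • J + jump q x) ∧ IsUnit ((2 : ℂ) • J - jump q x))
    (x₀ : ℝ) (hx₀ : x₀ ∈ interval a b)
    (T : Submodule ℂ ((weight w).L2 × (weight w).L2))
    (hTmax : (T : Set ((weight w).L2 × (weight w).L2)) ⊆ Tmax J q w)
    (hTself : T.adjoint = T)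
    (x : ℝ) (hx : x ∈ interval a b) (z : ℂ) (hz : z ∈ relResolventSet T) :
    (∀ f : (weight w).L2Fun, ∃ v : (weight w).L2Fun, IsResolventEval J q w x₀ T z f v ∧
      ∀ v' : (weight w).L2Fun, IsResolventEval J q w x₀ T z f v' →
        Set.EqOn (v' : ℝ → Fin n → ℂ) v (interval a b)) ∧
    ∃ G : ℝ → Matrix (Fin n) (Fin n) ℂ,
      (∀ j : Fin n, (weight w).MemL2 fun y => (G y)ᴴ.col j) ∧
      ∀ f v : (weight w).L2Fun, IsResolventEval J q w x₀ T z f v →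
        ∀ i : Fin n, v x i =
          ∫ y, (G y *ᵥ ((weight w).W y *ᵥ f y)) i ∂(weight w).S := by
  have hΩ := ordConnected_interval a b
  refine ⟨fun f => ?_, ?_⟩
  · obtain ⟨u, hu⟩ := exists_resolvent hz ((weight w).toL2 f)
    obtain ⟨v, hv⟩ := exists_isEvaluation (x₀ := x₀) (hTmax hu)
    refine ⟨v, ⟨u, hu, hv⟩, ?_⟩
    rintro v' ⟨u', hu', hv'⟩
    obtain rfl := resolvent_unique hz hu hu'
    exact hv'.eqOn hΩ hJ hjump hx₀ hv
  · obtain ⟨E, hE⟩ := exists_continuous_evaluation hΩ hJ hjump hx₀ hx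
      (isClosed_of_adjoint_eq hTself) hTmax hz
    obtain ⟨G, hG, hGE⟩ := (weight w).exists_kernel E
    exact ⟨G, hG, fun f v hv i => by rw [hE f v hv, hGE]⟩
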